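/- Let $L$ be a lattice. A median of $L$ is a symmetric monotone operation $f:L^3\to L$ with $f(x,x,y)=f(x,y,x)=f(y,x,x)=x$ for all $x,y$. The medians of $L$ form a sublattice $\mathrm{OM}\,L$ (the outer median lattice) of $L^{L^3}$, and the medians that are induced by ternary lattice terms form a sublattice $\mathrm{IM}\,L$ (the inner median lattice). The permitted interval of $(x_1,x_2,x_3)$ is $[m,M]$ with $m=(x_1\wedge x_2)\vee(x_1\wedge x_3)\vee(x_2\wedge x_3)$ and $M=(x_1\vee x_2)\wedge(x_1\vee x_3)\wedge(x_2\vee x_3)$. The T-poset $\mathcal T_L$ consists of the three-element subsets of $L$ with permitted interval having more than one element, where $S\le S'$ iff there is a bijection $\sigma:S\to S'$ with $x\le\sigma(x)$ for all $x\in S$. Write $abc$ for $\{a,b,c\}$, let $\mathbf n$ be the $n$-element chain, and let $L^{\mathbf 2}$ denote the lattice of monotone maps $\mathbf 2\to L$; products such as $\mathbf 2^2$, $\mathbf 3^2$, $M_4^4$ are direct. Consider the following lattices, with least element $0$ and greatest element $1$, whose other elements are $a,b,c$ (for $M_3$, $N_5$) or $a,b,c,d$ (for the others), and in which the strict comparabilities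 not involving $0$ or $1$ are exactly those listed: $M_3$: none; $N_5$: $a<c$; $M_4$: none; $A_1$: $a<c$; $A_2$: $a<c$, $b<d$; $A_3$: $a<c<d$; $L_4$: $a<d$, $b<d$; $L_5$: $d<a$, $d<b$; $B_1$: $a,b,c<d$; $B_2$: $d<a,b,c$; $B_3$: $a<c<d$, $b<d$; $B_4$: $d<c<a$, $d<b$. Then every lattice with at most six elements is either distributive, in which case $\mathcal T_L$ is empty and $\mathrm{OM}\,L$ and $\mathrm{IM}\,L$ have exactly one element, or isomorphic to exactly one of these twelve lattices. None of the twelve is distributive, and their T-posets (listed with their elements and covering pairs), outer median lattices and inner median lattices are: - $M_3$: $\mathcal T=\{abc\}$; $\mathrm{OM}\cong M_3$; $\mathrm{IM}\cong\mathbf 2$. - $N_5$: $\mathcal T=\{abc\}$; $\mathrm{OM}\cong\mathbf 2$; $\mathrm{IM}\cong\mathbf 2$. - $M_4$: $\mathcal T=\{abc,abd,acd,bcd\}$, an antichain; $\mathrm{OM}\cong M_4^4$; $\mathrm{IM}\cong\mathbf 2$. - $A_1$: $\mathcal T=\{abc,acd,abd,bcd\}$ with the only cover $abd\prec bcd$;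 $\mathrm{OM}\cong\mathbf 2^2\times A_1^{\mathbf 2}$, so $|\mathrm{OM}\,A_1|=64$; $\mathrm{IM}\cong\mathbf 2^2$. - $A_2$: $\mathcal T=\{abc,acd,abd,bcd\}$ with the covers $abc\prec acd$ and $abd\prec bcd$; $\mathrm{OM}\cong\mathbf 3^2$; $\mathrm{IM}\cong\mathbf 2$. - $A_3$: $\mathcal T$ is the chain $abc\prec abd\prec bcd$; $\mathrm{OM}$ is the eight-element lattice on $\{aab,aac,abb,abc,acc,bbb,bbc,bcc\}$ with the covers $aab\prec aac$, $aab\prec abb$, $aac\prec abc$, $abb\prec abc$, $abb\prec bbb$, $abc\prec acc$, $abc\prec bbc$, $bbb\prec bbc$, $acc\prec bcc$, $bbc\prec bcc$ (these eight names are formal symbols); $\mathrm{IM}\cong\mathbf 2$. - $L_4$: $\mathcal T=\{abc,acd,bcd\}$ with the covers $abc\prec acd$ and $abc\prec bcd$; $\mathrm{OM}\cong\mathbf 3^2$, where, writing a median as the word of its values at $(a,b,c)$, $(a,c,d)$, $(b,c,d)$, the elements $(i,j)\in\{0,1,2\}^2$ for $i=0$, $j=0,1,2$ are $0ab,0ad,aad$;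 for $i=1$: $0db,0dd,add$; for $i=2$: $bdb,bdd,ddd$; $\mathrm{IM}\cong\mathbf 3$. - $L_5$: $\mathcal T=\{abc,acd,bcd\}$ with the covers $acd\prec abc$ and $bcd\prec abc$; $\mathrm{OM}\cong\mathbf 3^2$; $\mathrm{IM}\cong\mathbf 3$. - $B_1$ and $B_2$: $\mathcal T=\{abc\}$; $\mathrm{OM}\cong M_3$; $\mathrm{IM}\cong\mathbf 2$. - $B_3$ and $B_4$: $\mathcal T=\{abc\}$; $\mathrm{OM}\cong\mathbf 2$; $\mathrm{IM}\cong\mathbf 2$. -/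

import Mathlib

namespace LatticeMedian

/-! ### Medians of a lattice -/

section Medians

variable (L : Type*) [Lattice L]

/-- A median of `L`: a symmetric monotone majority operation `L³ → L`. -/
structure IsMedian {L : Type*} [Lattice L] (f : (Fin 3 → L) → L) : Prop where
  symmetric : ∀ (σ : Equiv.Perm (Fin 3)) (x : Fin 3 → L), f (x ∘ σ) = f x
  monotone : Monotone f
  majority : ∀ x y : L, f ![x, x, y] = x ∧ f ![x, y, x] = x ∧ f ![y, x, x] = x

/-- Lattice terms in the variables `x₁, …, xₙ`. -/
inductive LatticeTerm (n : ℕ) : Type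
  | var : Fin n → LatticeTerm n
  | meet : LatticeTerm n → LatticeTerm n → LatticeTerm n
  | join : LatticeTerm n → LatticeTerm n → LatticeTerm n

/-- The operation that a lattice term induces on `L`. -/
def LatticeTerm.eval {L : Type*} [Lattice L] {n : ℕ} : LatticeTerm n → (Fin n → L) → L
  | .var k, x => x k
  | .meet s t, x => s.eval x ⊓ t.eval x
  | .join s t, x => s.eval x ⊔ t.eval x

/-- The outer median lattice of `L`: all medians of `L`, as a sublattice of the power `L^(L³)`. -/
def OM : Sublattice ((Fin 3 → L) → L) where
  carrier := {f | IsMedian f}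
  supClosed' := fun f hf g hg =>
    { symmetric := fun σ x => by simp [hf.symmetric σ x, hg.symmetric σ x]
      monotone := hf.monotone.sup hg.monotone
      majority := fun x y => by
        obtain ⟨h1, h2, h3⟩ := hf.majority x y
        obtain ⟨k1, k2, k3⟩ := hg.majority x y
        simp [h1, h2, h3, k1, k2, k3] }
  infClosed' := fun f hf g hg =>
    { symmetric := fun σ x => by simp [hf.symmetric σ x, hg.symmetric σ x]
      monotone := hf.monotone.inf hg.monotone
      majority := fun x y => by
        obtain ⟨h1, h2, h3⟩ := hf.majority x y
        obtain ⟨k1, k2, k3⟩ := hg.majority x y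
        simp [h1, h2, h3, k1, k2, k3] }

/-- The inner median lattice of `L`: the medians of `L` that are term functions. -/
def IM : Sublattice ((Fin 3 → L) → L) where
  carrier := {f | f ∈ OM L ∧ ∃ t : LatticeTerm 3, t.eval = f}
  supClosed' := by
    rintro f ⟨hf, s, rfl⟩ g ⟨hg, t, rfl⟩
    exact ⟨(OM L).sup_mem hf hg, s.join t, rfl⟩
  infClosed' := by
    rintro f ⟨hf, s, rfl⟩ g ⟨hg, t, rfl⟩
    exact ⟨(OM L).inf_mem hf hg, s.meet t, rfl⟩

/-- The lower median `(x₁ ∧ x₂) ∨ (x₁ ∧ x₃) ∨ (x₂ ∧ x₃)`. -/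
def lowerMedian {L : Type*} [Lattice L] (x : Fin 3 → L) : L :=
  (x 0 ⊓ x 1) ⊔ (x 0 ⊓ x 2) ⊔ (x 1 ⊓ x 2)

/-- The upper median `(x₁ ∨ x₂) ∧ (x₁ ∨ x₃) ∧ (x₂ ∨ x₃)`. -/
def upperMedian {L : Type*} [Lattice L] (x : Fin 3 → L) : L :=
  (x 0 ⊔ x 1) ⊓ (x 0 ⊔ x 2) ⊓ (x 1 ⊔ x 2)

/-- The permitted interval of a triple. -/
def permittedInterval {L : Type*} [Lattice L] (x : Fin 3 → L) : Set L :=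
  Set.Icc (lowerMedian x) (upperMedian x)

/-- The underlying set of the T-poset of `L`: the three-element subsets of `L` whose permitted
interval is nontrivial (has more than one element). -/
@[ext]
structure TPoset where
  carrier : Set L
  exists_triple : ∃ x : Fin 3 → L,
    Function.Injective x ∧ Set.range x = carrier ∧ (permittedInterval x).Nontrivial

/-- The order of the T-poset: `s ≤ t` if and only if the elements of `s` can be matched
bijectively with elements of `t` that are at least as large. -/
instance : PartialOrder (TPoset L) where
  le s t := ∃ e : s.carrier ≃ t.carrier, ∀ p : s.carrier, (p : L) ≤ (e p : L)
  le_refl s := ⟨Equiv.refl _, fun p => le_refl _⟩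
  le_trans s t u := by
    rintro ⟨e, he⟩ ⟨e', he'⟩
    exact ⟨e.trans e', fun p => (he p).trans (he' (e p))⟩
  le_antisymm s t := by
    rintro ⟨e, he⟩ ⟨e', he'⟩
    have hfin : Finite s.carrier := by
      obtain ⟨x, -, hx, -⟩ := s.exists_triple
      rw [← hx]
      exact Set.finite_range x
    have hmon : ∀ (n : ℕ) (p : s.carrier), (p : L) ≤ (((e.trans e') ^ n) p : s.carrier) := by
      intro n
      induction n with
      | zero => intro p; exact le_refl _
      | succ n ih =>
        intro p
        rw [pow_succ]
        exact ((he p).trans (he' (e p))).trans (ih _)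
    have hfix : ∀ p : s.carrier, (e p : L) = p := by
      intro p
      obtain ⟨n, hn, hn1⟩ := (isOfFinOrder_of_finite (e.trans e')).exists_pow_eq_one
      obtain ⟨k, rfl⟩ : ∃ k, n = k + 1 := ⟨n - 1, by omega⟩
      have h := hmon k (e' (e p))
      have h2 : ((e.trans e') ^ k) (e' (e p)) = p := by
        have := congrArg (fun g : Equiv.Perm s.carrier => g p) hn1
        simpa [pow_succ] using this
      rw [h2] at h
      exact le_antisymm ((he' (e p)).trans h) (he p)
    ext y
    constructor
    · intro hy
      have h := (e ⟨y, hy⟩).2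
      rwa [hfix ⟨y, hy⟩] at h
    · intro hy
      have h := hfix (e.symm ⟨y, hy⟩)
      rw [e.apply_symm_apply] at h
      change y = _ at h
      rw [h]
      exact (e.symm ⟨y, hy⟩).2

/-- The T-poset of `L` consists of the three-element sets in `nodes`, and the edges of its Hasse
diagram, each directed upwards, are those in `edges`. -/
def HasTPoset (nodes : Set (Set L)) (edges : Set (Set L × Set L)) : Prop :=
  Set.range (TPoset.carrier : TPoset L → Set L) = nodes ∧
    ∀ s t : TPoset L, s ⋖ t ↔ (s.carrier, t.carrier) ∈ edges

/-- Up to the naming of its elements, `P` has the Hasse diagram with the vertices `V` and the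
(upwards directed) edges `edges`. -/
def HasHasseDiagram (P : Type*) [PartialOrder P] {V : Type*} (edges : Set (V × V)) : Prop :=
  ∃ v : V ≃ P, ∀ i j : V, v i ⋖ v j ↔ (i, j) ∈ edges

/-- The distributive law. -/
def Distributive : Prop :=
  ∀ x y z : L, x ⊓ (y ⊔ z) = (x ⊓ y) ⊔ (x ⊓ z)

end Medians

/-! ### The lattices of the table

Each lattice is given by its order relation, as a Boolean function, and by the joins and meets of
its pairs of incomparable elements. -/

/-- The join determined by an order and by the joins of incomparable elements. -/
def joinOf {α : Type} (leq : α → α → Bool) (j : α → α → α) (x y : α) : α :=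
  if leq x y then y else if leq y x then x else j x y

/-- The meet determined by an order and by the meets of incomparable elements. -/
def meetOf {α : Type} (leq : α → α → Bool) (m : α → α → α) (x y : α) : α :=
  if leq x y then x else if leq y x then y else m x y

/-- The lattice with the order `leq` and with the given joins and meets of incomparable
elements; the lattice axioms are checked in `h`. -/
abbrev latticeOf {α : Type} (leq : α → α → Bool) (j m : α → α → α)
    (h : (∀ x, leq x x) ∧ (∀ x y, leq x y → leq y x → x = y) ∧
      ∀ x y, leq x (joinOf leq j x y) ∧ leq y (joinOf leq j x y) ∧
        leq (meetOf leq m x y) x ∧ leq (meetOf leq m x y) y ∧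
        ∀ z, (leq x y → leq y z → leq x z) ∧
          (leq x z → leq y z → leq (joinOf leq j x y) z) ∧
          (leq z x → leq z y → leq z (meetOf leq m x y))) : Lattice α where
  le x y := leq x y = true
  le_refl := h.1
  le_trans x y z := ((h.2.2 x y).2.2.2.2 z).1
  le_antisymm := h.2.1
  sup := joinOf leq j
  inf := meetOf leq m
  le_sup_left x y := (h.2.2 x y).1
  le_sup_right x y := (h.2.2 x y).2.1
  sup_le x y z := ((h.2.2 x y).2.2.2.2 z).2.1
  inf_le_left x y := (h.2.2 x y).2.2.1
  inf_le_right x y := (h.2.2 x y).2.2.2.1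
  le_inf z x y := ((h.2.2 x y).2.2.2.2 z).2.2

/-- The lattice `M3`: three pairwise incomparable elements `a`, `b`, `c` between `bot` and `top`. -/
inductive M3 : Type
  | bot | a | b | c | top
  deriving DecidableEq

instance : Fintype M3 := ⟨{.bot, .a, .b, .c, .top}, fun x => by cases x <;> decide⟩

/-- The order of `M3`. -/
def M3.leq : M3 → M3 → Bool
  | .bot, _ | _, .top => true
  | x, y => x == y

instance : Lattice M3 :=
  latticeOf M3.leq (fun _ _ => .top) (fun _ _ => .bot) (by decide)

instance : DecidableLE M3 := fun x y => inferInstanceAs (Decidable (x.leq y = true))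

/-- The lattice `N5`: the pentagon, with `a < c` and `b` incomparable to both. -/
inductive N5 : Type
  | bot | a | b | c | top
  deriving DecidableEq

instance : Fintype N5 := ⟨{.bot, .a, .b, .c, .top}, fun x => by cases x <;> decide⟩

/-- The order of `N5`. -/
def N5.leq : N5 → N5 → Bool
  | .bot, _ | _, .top | .a, .c => true
  | x, y => x == y

instance : Lattice N5 :=
  latticeOf N5.leq (fun _ _ => .top) (fun _ _ => .bot) (by decide)

instance : DecidableLE N5 := fun x y => inferInstanceAs (Decidable (x.leq y = true))

/-- The lattice `M4`: four pairwise incomparable elements between `bot` and `top`. -/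
inductive M4 : Type
  | bot | a | b | c | d | top
  deriving DecidableEq

instance : Fintype M4 := ⟨{.bot, .a, .b, .c, .d, .top}, fun x => by cases x <;> decide⟩

/-- The order of `M4`. -/
def M4.leq : M4 → M4 → Bool
  | .bot, _ | _, .top => true
  | x, y => x == y

instance : Lattice M4 :=
  latticeOf M4.leq (fun _ _ => .top) (fun _ _ => .bot) (by decide)

instance : DecidableLE M4 := fun x y => inferInstanceAs (Decidable (x.leq y = true))

/-- The lattice `A1`: `bot < a < c < top`, `bot < b < top`, `bot < d < top`. -/
inductive A1 : Type
  | bot | a | b | c | d | top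
  deriving DecidableEq

instance : Fintype A1 := ⟨{.bot, .a, .b, .c, .d, .top}, fun x => by cases x <;> decide⟩

/-- The order of `A1`. -/
def A1.leq : A1 → A1 → Bool
  | .bot, _ | _, .top | .a, .c => true
  | x, y => x == y

instance : Lattice A1 :=
  latticeOf A1.leq (fun _ _ => .top) (fun _ _ => .bot) (by decide)

instance : DecidableLE A1 := fun x y => inferInstanceAs (Decidable (x.leq y = true))

/-- The lattice `A2`: `bot < a < c < top`, `bot < b < d < top`. -/
inductive A2 : Type
  | bot | a | b | c | d | top
  deriving DecidableEq

instance : Fintype A2 := ⟨{.bot, .a, .b, .c, .d, .top}, fun x => by cases x <;> decide⟩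

/-- The order of `A2`. -/
def A2.leq : A2 → A2 → Bool
  | .bot, _ | _, .top | .a, .c | .b, .d => true
  | x, y => x == y

instance : Lattice A2 :=
  latticeOf A2.leq (fun _ _ => .top) (fun _ _ => .bot) (by decide)

instance : DecidableLE A2 := fun x y => inferInstanceAs (Decidable (x.leq y = true))

/-- The lattice `A3`: `bot < a < c < d < top`, `bot < b < top`. -/
inductive A3 : Type
  | bot | a | b | c | d | top
  deriving DecidableEq

instance : Fintype A3 := ⟨{.bot, .a, .b, .c, .d, .top}, fun x => by cases x <;> decide⟩

/-- The order of `A3`. -/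
def A3.leq : A3 → A3 → Bool
  | .bot, _ | _, .top | .a, .c | .a, .d | .c, .d => true
  | x, y => x == y

instance : Lattice A3 :=
  latticeOf A3.leq (fun _ _ => .top) (fun _ _ => .bot) (by decide)

instance : DecidableLE A3 := fun x y => inferInstanceAs (Decidable (x.leq y = true))

/-- The lattice `L4`: `bot < a < d < top`, `bot < b < d`, `bot < c < top`. -/
inductive L4 : Type
  | bot | a | b | c | d | top
  deriving DecidableEq

instance : Fintype L4 := ⟨{.bot, .a, .b, .c, .d, .top}, fun x => by cases x <;> decide⟩

/-- The order of `L4`. -/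
def L4.leq : L4 → L4 → Bool
  | .bot, _ | _, .top | .a, .d | .b, .d => true
  | x, y => x == y

instance : Lattice L4 :=
  latticeOf L4.leq (fun | .a, .b => .d | .b, .a => .d | _, _ => .top) (fun _ _ => .bot) (by decide)

instance : DecidableLE L4 := fun x y => inferInstanceAs (Decidable (x.leq y = true))

/-- The lattice `L5`: the dual of `L4`: `bot < d < a < top`, `d < b < top`, `bot < c < top`. -/
inductive L5 : Type
  | bot | a | b | c | d | top
  deriving DecidableEq

instance : Fintype L5 := ⟨{.bot, .a, .b, .c, .d, .top}, fun x => by cases x <;> decide⟩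

/-- The order of `L5`. -/
def L5.leq : L5 → L5 → Bool
  | .bot, _ | _, .top | .d, .a | .d, .b => true
  | x, y => x == y

instance : Lattice L5 :=
  latticeOf L5.leq (fun _ _ => .top) (fun | .a, .b => .d | .b, .a => .d | _, _ => .bot) (by decide)

instance : DecidableLE L5 := fun x y => inferInstanceAs (Decidable (x.leq y = true))

/-- The lattice `B1`: `M3` (with largest element `d`) and a new largest element. -/
inductive B1 : Type
  | bot | a | b | c | d | top
  deriving DecidableEq

instance : Fintype B1 := ⟨{.bot, .a, .b, .c, .d, .top}, fun x => by cases x <;> decide⟩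

/-- The order of `B1`. -/
def B1.leq : B1 → B1 → Bool
  | .bot, _ | _, .top | .a, .d | .b, .d | .c, .d => true
  | x, y => x == y

instance : Lattice B1 :=
  latticeOf B1.leq (fun _ _ => .d) (fun _ _ => .bot) (by decide)

instance : DecidableLE B1 := fun x y => inferInstanceAs (Decidable (x.leq y = true))

/-- The lattice `B2`: `M3` (with smallest element `d`) and a new smallest element. -/
inductive B2 : Type
  | bot | a | b | c | d | top
  deriving DecidableEq

instance : Fintype B2 := ⟨{.bot, .a, .b, .c, .d, .top}, fun x => by cases x <;> decide⟩

/-- The order of `B2`. -/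
def B2.leq : B2 → B2 → Bool
  | .bot, _ | _, .top | .d, .a | .d, .b | .d, .c => true
  | x, y => x == y

instance : Lattice B2 :=
  latticeOf B2.leq (fun _ _ => .top) (fun _ _ => .d) (by decide)

instance : DecidableLE B2 := fun x y => inferInstanceAs (Decidable (x.leq y = true))

/-- The lattice `B3`: `N5` (with `a < c` and largest element `d`) and a new largest element. -/
inductive B3 : Type
  | bot | a | b | c | d | top
  deriving DecidableEq

instance : Fintype B3 := ⟨{.bot, .a, .b, .c, .d, .top}, fun x => by cases x <;> decide⟩

/-- The order of `B3`. -/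
def B3.leq : B3 → B3 → Bool
  | .bot, _ | _, .top | .a, .c | .a, .d | .b, .d | .c, .d => true
  | x, y => x == y

instance : Lattice B3 :=
  latticeOf B3.leq (fun _ _ => .d) (fun _ _ => .bot) (by decide)

instance : DecidableLE B3 := fun x y => inferInstanceAs (Decidable (x.leq y = true))

/-- The lattice `B4`: `N5` (with `c < a` and smallest element `d`) and a new smallest element. -/
inductive B4 : Type
  | bot | a | b | c | d | top
  deriving DecidableEq

instance : Fintype B4 := ⟨{.bot, .a, .b, .c, .d, .top}, fun x => by cases x <;> decide⟩

/-- The order of `B4`. -/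
def B4.leq : B4 → B4 → Bool
  | .bot, _ | _, .top | .c, .a | .d, .a | .d, .b | .d, .c => true
  | x, y => x == y

instance : Lattice B4 :=
  latticeOf B4.leq (fun _ _ => .top) (fun _ _ => .d) (by decide)

instance : DecidableLE B4 := fun x y => inferInstanceAs (Decidable (x.leq y = true))

/-- The names of the lattices of the table. -/
inductive TableName : Type
  | M3 | N5 | M4 | A1 | A2 | A3 | L4 | L5 | B1 | B2 | B3 | B4

/-- The lattice with a given name. -/
def TableName.Carrier : TableName → Type
  | .M3 => LatticeMedian.M3
  | .N5 => LatticeMedian.N5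
  | .M4 => LatticeMedian.M4
  | .A1 => LatticeMedian.A1
  | .A2 => LatticeMedian.A2
  | .A3 => LatticeMedian.A3
  | .L4 => LatticeMedian.L4
  | .L5 => LatticeMedian.L5
  | .B1 => LatticeMedian.B1
  | .B2 => LatticeMedian.B2
  | .B3 => LatticeMedian.B3
  | .B4 => LatticeMedian.B4

instance (n : TableName) : Lattice n.Carrier :=
  match n with
  | .M3 => inferInstanceAs (Lattice LatticeMedian.M3)
  | .N5 => inferInstanceAs (Lattice LatticeMedian.N5)
  | .M4 => inferInstanceAs (Lattice LatticeMedian.M4)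
  | .A1 => inferInstanceAs (Lattice LatticeMedian.A1)
  | .A2 => inferInstanceAs (Lattice LatticeMedian.A2)
  | .A3 => inferInstanceAs (Lattice LatticeMedian.A3)
  | .L4 => inferInstanceAs (Lattice LatticeMedian.L4)
  | .L5 => inferInstanceAs (Lattice LatticeMedian.L5)
  | .B1 => inferInstanceAs (Lattice LatticeMedian.B1)
  | .B2 => inferInstanceAs (Lattice LatticeMedian.B2)
  | .B3 => inferInstanceAs (Lattice LatticeMedian.B3)
  | .B4 => inferInstanceAs (Lattice LatticeMedian.B4)

/-- The vertices of the Hasse diagram of the outer median lattice of `A3`. -/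
inductive OMA3Vertex : Type
  | aab | aac | abb | abc | acc | bbb | bbc | bcc

open OMA3Vertex in
/-- The edges of the Hasse diagram of the outer median lattice of `A3`. -/
def omA3Edges : Set (OMA3Vertex × OMA3Vertex) :=
  {(aab, aac), (aab, abb), (aac, abc), (abb, abc), (abb, bbb), (abc, acc), (abc, bbc),
    (bbb, bbc), (acc, bcc), (bbc, bcc)}

open L4 in
/-- The labels in the diagram of the outer median lattice of `L4`: each median is labelled by its
values at the triples `abc`, `acd` and `bcd`. -/
def omL4Label : Fin 3 → Fin 3 → Fin 3 → L4 :=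
  ![![![bot, a, b], ![bot, a, d], ![a, a, d]],
    ![![bot, d, b], ![bot, d, d], ![a, d, d]],
    ![![b, d, b], ![b, d, d], ![d, d, d]]]

end LatticeMedian

open LatticeMedian

/-!
A median `f` satisfies `lowerMedian x ≤ f x ≤ upperMedian x`: by monotonicity and majority,
`x₁ ∧ x₂ = f (x₁ ∧ x₂, x₁ ∧ x₂, x₃) ≤ f x`, and similarly for the other bounds. So `f` is forced on
every triple with a trivial permitted interval, and by symmetry it is determined by its values on
one listing of each element of the T-poset. Conversely, any values on the T-poset that are monotone
and lie in the permitted intervals extend to a median (`isMedian_extend`): between two comparable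
triples at least one of which has a trivial permitted interval, monotonicity follows from that of
`lowerMedian` and `upperMedian`. Hence `OM L` is the lattice of admissible values on the T-poset
(`exists_orderIso_OM`). For the lattices of the table the T-poset has at most four elements, and the
admissible values are found by a finite check. In a distributive lattice the two bounds coincide,
so there is exactly one median and the T-poset is empty.

Term functions preserve the sublattices of `L × L`, in particular the graphs of isomorphisms between
sublattices of `L`. Such graphs link the values of an inner median at different triples of the
T-poset, or at one triple and a permutation of it. In each lattice of the table these constraints
leave only the values of the terms `imLower`, `imUpper`, `imLowerRaise` and `imUpperReduce`, which
are medians in every lattice (`nonempty_orderIso_IM`).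

For the classification, a lattice with `n ≤ 6` elements is enumerated along a linear extension of
its order. Its first and last elements are then the bounds, so the order is given by the at most six
comparisons between the other elements. Each of the at most `64` relations either fails to be a
lattice order, or is distributive, or is the order of a lattice of the table
(`matrix5_cases`, `matrix6_cases`). Counting triples `x ≤ y, z` and `y, z ≤ x` shows that the
lattices of the table are pairwise nonisomorphic.
-/

namespace LatticeMedian

section General

variable {L : Type*} [Lattice L]

/-! ### Lower and upper medians -/

/-- The six ways of listing the values of a permutation of three points. -/
theorem perm_fin_three_cases (σ : Equiv.Perm (Fin 3)) :
    (σ 0 = 0 ∧ σ 1 = 1 ∧ σ 2 = 2) ∨ (σ 0 = 0 ∧ σ 1 = 2 ∧ σ 2 = 1) ∨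
    (σ 0 = 1 ∧ σ 1 = 0 ∧ σ 2 = 2) ∨ (σ 0 = 1 ∧ σ 1 = 2 ∧ σ 2 = 0) ∨
    (σ 0 = 2 ∧ σ 1 = 0 ∧ σ 2 = 1) ∨ (σ 0 = 2 ∧ σ 1 = 1 ∧ σ 2 = 0) := by
  revert σ; decide

theorem lowerMedian_comp_perm (σ : Equiv.Perm (Fin 3)) (x : Fin 3 → L) :
    lowerMedian (x ∘ σ) = lowerMedian x := by
  rcases perm_fin_three_cases σ with ⟨h0, h1, h2⟩ | ⟨h0, h1, h2⟩ | ⟨h0, h1, h2⟩ |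
    ⟨h0, h1, h2⟩ | ⟨h0, h1, h2⟩ | ⟨h0, h1, h2⟩ <;>
    simp only [lowerMedian, Function.comp_apply, h0, h1, h2] <;> ac_rfl

theorem upperMedian_comp_perm (σ : Equiv.Perm (Fin 3)) (x : Fin 3 → L) :
    upperMedian (x ∘ σ) = upperMedian x := by
  rcases perm_fin_three_cases σ with ⟨h0, h1, h2⟩ | ⟨h0, h1, h2⟩ | ⟨h0, h1, h2⟩ |
    ⟨h0, h1, h2⟩ | ⟨h0, h1, h2⟩ | ⟨h0, h1, h2⟩ <;>
    simp only [upperMedian, Function.comp_apply, h0, h1, h2] <;> ac_rfl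

theorem lowerMedian_mono : Monotone (lowerMedian : (Fin 3 → L) → L) := fun x y h => by
  have h0 := h 0
  have h1 := h 1
  have h2 := h 2
  unfold lowerMedian
  gcongr

theorem upperMedian_mono : Monotone (upperMedian : (Fin 3 → L) → L) := fun x y h => by
  have h0 := h 0
  have h1 := h 1
  have h2 := h 2
  unfold upperMedian
  gcongr

theorem lowerMedian_le_upperMedian (x : Fin 3 → L) : lowerMedian x ≤ upperMedian x := by
  refine sup_le (sup_le ?_ ?_) ?_ <;> refine le_inf (le_inf ?_ ?_) ?_
  all_goals first
    | exact inf_le_left.trans le_sup_left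
    | exact inf_le_left.trans le_sup_right
    | exact inf_le_right.trans le_sup_left
    | exact inf_le_right.trans le_sup_right

theorem isMedian_lowerMedian : IsMedian (lowerMedian : (Fin 3 → L) → L) where
  symmetric := lowerMedian_comp_perm
  monotone := lowerMedian_mono
  majority x y := by simp [lowerMedian]

theorem isMedian_upperMedian : IsMedian (upperMedian : (Fin 3 → L) → L) where
  symmetric := upperMedian_comp_perm
  monotone := upperMedian_mono
  majority x y := by simp [upperMedian]

theorem IsMedian.lowerMedian_le {f : (Fin 3 → L) → L} (hf : IsMedian f) (x : Fin 3 → L) :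
    lowerMedian x ≤ f x := by
  refine sup_le (sup_le ?_ ?_) ?_
  · rw [← (hf.majority (x 0 ⊓ x 1) (x 2)).1]
    refine hf.monotone fun i => ?_
    fin_cases i <;> simp
  · rw [← (hf.majority (x 0 ⊓ x 2) (x 1)).2.1]
    refine hf.monotone fun i => ?_
    fin_cases i <;> simp
  · rw [← (hf.majority (x 1 ⊓ x 2) (x 0)).2.2]
    refine hf.monotone fun i => ?_
    fin_cases i <;> simp

theorem IsMedian.le_upperMedian {f : (Fin 3 → L) → L} (hf : IsMedian f) (x : Fin 3 → L) :
    f x ≤ upperMedian x := by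
  refine le_inf (le_inf ?_ ?_) ?_
  · rw [← (hf.majority (x 0 ⊔ x 1) (x 2)).1]
    refine hf.monotone fun i => ?_
    fin_cases i <;> simp
  · rw [← (hf.majority (x 0 ⊔ x 2) (x 1)).2.1]
    refine hf.monotone fun i => ?_
    fin_cases i <;> simp
  · rw [← (hf.majority (x 1 ⊔ x 2) (x 0)).2.2]
    refine hf.monotone fun i => ?_
    fin_cases i <;> simp

/-! ### Reduction to representative triples -/

/-- Up to permuting its entries, `x` lies below `y`. -/
def PermLE (x y : Fin 3 → L) : Prop := ∃ σ : Equiv.Perm (Fin 3), ∀ l, x (σ l) ≤ y l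

instance [DecidableLE L] (x y : Fin 3 → L) : Decidable (PermLE x y) :=
  inferInstanceAs (Decidable (∃ σ : Equiv.Perm (Fin 3), ∀ l, x (σ l) ≤ y l))

/-- Up to permuting their entries, the triples with a nontrivial permitted interval all occur in
the family `t`. -/
def Covers {k : ℕ} (t : Fin k → Fin 3 → L) : Prop :=
  ∀ x : Fin 3 → L, lowerMedian x = upperMedian x ∨
    ∃ i, ∃ σ : Equiv.Perm (Fin 3), x = t i ∘ σ

theorem covers_of_forall {k : ℕ} {t : Fin k → Fin 3 → L}
    (h : ∀ a b c : L, lowerMedian ![a, b, c] = upperMedian ![a, b, c] ∨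
      ∃ i, ∃ σ : Equiv.Perm (Fin 3), ∀ l, ![a, b, c] l = t i (σ l)) : Covers t := fun x => by
  have hx : x = ![x 0, x 1, x 2] := by ext i; fin_cases i <;> rfl
  rw [hx]
  refine (h (x 0) (x 1) (x 2)).imp_right ?_
  rintro ⟨i, σ, h⟩
  exact ⟨i, σ, funext h⟩

/-- A family of values at the triples `t` that respects the permitted intervals and the order of
triples. -/
structure IsAdmissible {k : ℕ} (t : Fin k → Fin 3 → L) (g : Fin k → L) : Prop where
  lower_le : ∀ i, lowerMedian (t i) ≤ g i
  le_upper : ∀ i, g i ≤ upperMedian (t i)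
  mono : ∀ i j, PermLE (t i) (t j) → g i ≤ g j

variable {k : ℕ} {t : Fin k → Fin 3 → L}

instance [DecidableLE L] (t : Fin k → Fin 3 → L) (g : Fin k → L) : Decidable (IsAdmissible t g) :=
  decidable_of_iff ((∀ i, lowerMedian (t i) ≤ g i) ∧ (∀ i, g i ≤ upperMedian (t i)) ∧
      ∀ i j, PermLE (t i) (t j) → g i ≤ g j)
    ⟨fun h => ⟨h.1, h.2.1, h.2.2⟩, fun h => ⟨h.1, h.2, h.3⟩⟩

theorem IsMedian.isAdmissible {f : (Fin 3 → L) → L} (hf : IsMedian f) (t : Fin k → Fin 3 → L) :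
    IsAdmissible t fun i => f (t i) where
  lower_le i := hf.lowerMedian_le _
  le_upper i := hf.le_upperMedian _
  mono i j := by
    rintro ⟨σ, h⟩
    rw [← hf.symmetric σ (t i)]
    exact hf.monotone h

/-- Medians are compared at the representative triples: elsewhere they are all equal. -/
theorem IsMedian.le_iff (ht : Covers t) {f g : (Fin 3 → L) → L} (hf : IsMedian f)
    (hg : IsMedian g) : f ≤ g ↔ ∀ i, f (t i) ≤ g (t i) := by
  refine ⟨fun h i => h _, fun h x => ?_⟩
  rcases ht x with hx | ⟨i, σ, rfl⟩
  · exact (hf.le_upperMedian x).trans (hx ▸ hg.lowerMedian_le x)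
  · rw [hf.symmetric, hg.symmetric]
    exact h i

open Classical in
/-- The operation that takes the values `g` at the triples `t` and their permutations, and the
value of the lower median elsewhere. -/
noncomputable def extend (t : Fin k → Fin 3 → L) (g : Fin k → L) (x : Fin 3 → L) : L :=
  if h : ∃ i, ∃ σ : Equiv.Perm (Fin 3), x = t i ∘ σ then g h.choose else lowerMedian x

theorem extend_apply_comp {g : Fin k → L} (hg : IsAdmissible t g) (i : Fin k)
    (σ : Equiv.Perm (Fin 3)) : extend t g (t i ∘ σ) = g i := by
  have h : ∃ j, ∃ τ : Equiv.Perm (Fin 3), t i ∘ σ = t j ∘ τ := ⟨i, σ, rfl⟩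
  unfold extend
  rw [dif_pos h]
  obtain ⟨τ, hτ⟩ := h.choose_spec
  -- the chosen triple is a permutation of `t i`, so the values agree by monotonicity both ways
  have e : ∀ l, t i (σ l) = t h.choose (τ l) := fun l => congrFun hτ l
  refine le_antisymm (hg.mono _ _ ⟨σ.symm.trans τ, fun l => ?_⟩)
    (hg.mono _ _ ⟨τ.symm.trans σ, fun l => ?_⟩)
  · simp [← e]
  · simp [e]

theorem extend_mem_Icc (ht : Covers t) {g : Fin k → L} (hg : IsAdmissible t g) (x : Fin 3 → L) :
    lowerMedian x ≤ extend t g x ∧ extend t g x ≤ upperMedian x := by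
  by_cases h : ∃ i, ∃ σ : Equiv.Perm (Fin 3), x = t i ∘ σ
  · obtain ⟨i, σ, rfl⟩ := h
    rw [extend_apply_comp hg, lowerMedian_comp_perm, upperMedian_comp_perm]
    exact ⟨hg.lower_le i, hg.le_upper i⟩
  · have hx := (ht x).resolve_right h
    unfold extend
    rw [dif_neg h]
    exact ⟨le_rfl, hx.le⟩

/-- Admissible values extend to a median: two comparable triples, at least one of which has a
trivial permitted interval, have values separated by a lower or an upper median. -/
theorem isMedian_extend (ht : Covers t) {g : Fin k → L} (hg : IsAdmissible t g) :
    IsMedian (extend t g) := by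
  have hIcc := extend_mem_Icc ht hg
  have hconst : ∀ x, lowerMedian x = upperMedian x → extend t g x = lowerMedian x := fun x hx =>
    le_antisymm ((hIcc x).2.trans hx.ge) (hIcc x).1
  refine ⟨fun σ x => ?_, fun x y hxy => ?_, fun x y => ⟨?_, ?_, ?_⟩⟩
  · rcases ht x with hx | ⟨i, τ, rfl⟩
    · rw [hconst x hx, hconst (x ∘ σ) (by rwa [lowerMedian_comp_perm, upperMedian_comp_perm]),
        lowerMedian_comp_perm]
    · rw [extend_apply_comp hg, Function.comp_assoc, ← Equiv.coe_trans, extend_apply_comp hg]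
  · rcases ht x with hx | ⟨i, σ, rfl⟩
    · rw [hconst x hx]
      exact (lowerMedian_mono hxy).trans (hIcc y).1
    · rcases ht y with hy | ⟨j, τ, rfl⟩
      · rw [hconst y hy, hy]
        exact (hIcc _).2.trans (upperMedian_mono hxy)
      · rw [extend_apply_comp hg, extend_apply_comp hg]
        refine hg.mono _ _ ⟨τ.symm.trans σ, fun l => ?_⟩
        simpa using hxy (τ.symm l)
  · have h := hIcc ![x, x, y]
    simp only [lowerMedian, upperMedian] at h
    simp at h
    exact le_antisymm h.2 h.1
  · have h := hIcc ![x, y, x]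
    simp only [lowerMedian, upperMedian] at h
    simp at h
    exact le_antisymm h.2 h.1
  · have h := hIcc ![y, x, x]
    simp only [lowerMedian, upperMedian] at h
    simp at h
    exact le_antisymm h.2 h.1

/-- The outer median lattice is isomorphic to any order `P` that parametrizes the admissible
families of values. -/
theorem exists_orderIso_OM (ht : Covers t) {P : Type*} [PartialOrder P] (h : P → Fin k → L)
    (hle : ∀ p q, (∀ i, h p i ≤ h q i) ↔ p ≤ q) (hadm : ∀ p, IsAdmissible t (h p))
    (hsurj : ∀ g, IsAdmissible t g → ∃ p, ∀ i, h p i = g i) :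
    ∃ e : P ≃o OM L, ∀ p i, (e p).1 (t i) = h p i := by
  have hval : ∀ p i, extend t (h p) (t i) = h p i := fun p i =>
    extend_apply_comp (hadm p) i (Equiv.refl _)
  let e : P ↪o OM L := OrderEmbedding.ofMapLEIff
    (fun p => ⟨extend t (h p), isMedian_extend ht (hadm p)⟩) fun p q => by
      change extend t (h p) ≤ extend t (h q) ↔ _
      rw [(isMedian_extend ht (hadm p)).le_iff ht (isMedian_extend ht (hadm q)), ← hle]
      simp only [hval]
  refine ⟨RelIso.ofSurjective e fun f => ?_, hval⟩
  have hf : IsMedian f.1 := f.2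
  obtain ⟨p, hp⟩ := hsurj _ (hf.isAdmissible t)
  refine ⟨p, Subtype.ext (le_antisymm ?_ ?_)⟩
  · refine ((isMedian_extend ht (hadm p)).le_iff ht hf).2 fun i => ?_
    rw [hval, hp]
  · refine (hf.le_iff ht (isMedian_extend ht (hadm p))).2 fun i => ?_
    rw [hval, hp]

/-! ### Inner medians -/

/-- `R` lists the elements of a sublattice of `L × L` that relates the triple `t i`, in some order,
to the triple `t j`. Typically, `R` is the graph of an isomorphism between two sublattices. -/
def Transfers (t : Fin k → Fin 3 → L) (i j : Fin k) (R : List (L × L)) : Prop :=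
  (∀ p ∈ R, ∀ q ∈ R, p ⊓ q ∈ R ∧ p ⊔ q ∈ R) ∧
    ∃ σ : Equiv.Perm (Fin 3), ∀ l, (t i (σ l), t j l) ∈ R

instance [DecidableEq L] (t : Fin k → Fin 3 → L) (i j : Fin k) (R : List (L × L)) :
    Decidable (Transfers t i j R) :=
  inferInstanceAs (Decidable (_ ∧ _))

/-- Term functions preserve sublattices of `L × L`. -/
theorem Transfers.mem {i j : Fin k} {R : List (L × L)} (h : Transfers t i j R) (f : IM L) :
    (f.1 (t i), f.1 (t j)) ∈ R := by
  obtain ⟨f, hf : IsMedian f, s, hs⟩ := f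
  obtain ⟨hR, σ, hσ⟩ := h
  change (f (t i), f (t j)) ∈ R
  rw [← hf.symmetric σ (t i), ← hs]
  clear hs
  induction s with
  | var l => exact hσ l
  | meet s s' h h' => exact (hR _ h _ h').1
  | join s s' h h' => exact (hR _ h _ h').2

/-- The inner median lattice is isomorphic to an order `P` if inner medians are indexed by `P` in
an order-embedding way and if they exhaust the admissible values that respect a list `C` of
relations preserved by term functions. -/
theorem nonempty_orderIso_IM (ht : Covers t) {P : Type*} [PartialOrder P] (T : P → IM L)
    (C : List (Fin k × Fin k × List (L × L)))
    (hle : ∀ p q, (∀ i, (T p).1 (t i) ≤ (T q).1 (t i)) ↔ p ≤ q)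
    (hC : ∀ c ∈ C, Transfers t c.1 c.2.1 c.2.2)
    (hsurj : ∀ g : Fin k → L, (∀ c ∈ C, (g c.1, g c.2.1) ∈ c.2.2) → IsAdmissible t g →
      ∃ p, ∀ i, g i = (T p).1 (t i)) :
    Nonempty (IM L ≃o P) := by
  have hmed : ∀ f : IM L, IsMedian f.1 := fun f => f.2.1
  let e : P ↪o IM L := OrderEmbedding.ofMapLEIff T fun p q => by
    change (T p).1 ≤ (T q).1 ↔ _
    rw [(hmed _).le_iff ht (hmed _), hle]
  refine ⟨(RelIso.ofSurjective e fun f => ?_).symm⟩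
  obtain ⟨p, hp⟩ := hsurj _ (fun c hc => (hC c hc).mem f) ((hmed f).isAdmissible t)
  refine ⟨p, Subtype.ext (le_antisymm ?_ ?_)⟩
  · exact ((hmed _).le_iff ht (hmed _)).2 fun i => (hp i).ge
  · exact ((hmed _).le_iff ht (hmed _)).2 fun i => (hp i).le

/-- The term `(p ∧ q) ∨ (p ∧ r) ∨ (q ∧ r)`. -/
def lowerTerm (p q r : LatticeTerm 3) : LatticeTerm 3 :=
  ((p.meet q).join (p.meet r)).join (q.meet r)

/-- The term `(p ∨ q) ∧ (p ∨ r) ∧ (q ∨ r)`. -/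
def upperTerm (p q r : LatticeTerm 3) : LatticeTerm 3 :=
  ((p.join q).meet (p.join r)).meet (q.join r)

/-- The triple `(x₁ ∨ (x₂ ∧ x₃), x₂ ∨ (x₁ ∧ x₃), x₃ ∨ (x₁ ∧ x₂))`. -/
def raise (x : Fin 3 → L) : Fin 3 → L :=
  ![x 0 ⊔ (x 1 ⊓ x 2), x 1 ⊔ (x 0 ⊓ x 2), x 2 ⊔ (x 0 ⊓ x 1)]

/-- The triple `(x₁ ∧ (x₂ ∨ x₃), x₂ ∧ (x₁ ∨ x₃), x₃ ∧ (x₁ ∨ x₂))`. -/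
def reduce (x : Fin 3 → L) : Fin 3 → L :=
  ![x 0 ⊓ (x 1 ⊔ x 2), x 1 ⊓ (x 0 ⊔ x 2), x 2 ⊓ (x 0 ⊔ x 1)]

theorem isMedian_lowerMedian_raise : IsMedian fun x : Fin 3 → L => lowerMedian (raise x) where
  symmetric σ x := by
    rcases perm_fin_three_cases σ with ⟨h0, h1, h2⟩ | ⟨h0, h1, h2⟩ | ⟨h0, h1, h2⟩ |
      ⟨h0, h1, h2⟩ | ⟨h0, h1, h2⟩ | ⟨h0, h1, h2⟩ <;>
      simp [lowerMedian, raise, Function.comp_apply, h0, h1, h2] <;> ac_rfl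
  monotone x y h := by
    have h0 := h 0
    have h1 := h 1
    have h2 := h 2
    refine lowerMedian_mono fun i => ?_
    fin_cases i <;> simp only [raise] <;> simp <;>
      constructor <;> first
        | exact le_sup_of_le_left ‹_›
        | exact le_sup_of_le_right (inf_le_inf ‹_› ‹_›)
  majority x y := by simp [lowerMedian, raise]

theorem isMedian_upperMedian_reduce : IsMedian fun x : Fin 3 → L => upperMedian (reduce x) where
  symmetric σ x := by
    rcases perm_fin_three_cases σ with ⟨h0, h1, h2⟩ | ⟨h0, h1, h2⟩ | ⟨h0, h1, h2⟩ |
      ⟨h0, h1, h2⟩ | ⟨h0, h1, h2⟩ | ⟨h0, h1, h2⟩ <;>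
      simp [upperMedian, reduce, Function.comp_apply, h0, h1, h2] <;> ac_rfl
  monotone x y h := by
    have h0 := h 0
    have h1 := h 1
    have h2 := h 2
    refine upperMedian_mono fun i => ?_
    fin_cases i <;> simp only [reduce] <;> simp <;>
      constructor <;> first
        | exact inf_le_of_left_le ‹_›
        | exact inf_le_of_right_le (sup_le_sup ‹_› ‹_›)
  majority x y := by simp [upperMedian, reduce]

open LatticeTerm in
/-- The lower median, as an inner median. -/
def imLower (L : Type*) [Lattice L] : IM L :=
  ⟨lowerMedian, isMedian_lowerMedian, lowerTerm (var 0) (var 1) (var 2), rfl⟩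

open LatticeTerm in
/-- The upper median, as an inner median. -/
def imUpper (L : Type*) [Lattice L] : IM L :=
  ⟨upperMedian, isMedian_upperMedian, upperTerm (var 0) (var 1) (var 2), rfl⟩

open LatticeTerm in
/-- The lower median of the raised triple, as an inner median. -/
def imLowerRaise (L : Type*) [Lattice L] : IM L :=
  ⟨fun x => lowerMedian (raise x), isMedian_lowerMedian_raise,
    lowerTerm ((var 0).join ((var 1).meet (var 2))) ((var 1).join ((var 0).meet (var 2)))
      ((var 2).join ((var 0).meet (var 1))), rfl⟩

open LatticeTerm in
/-- The upper median of the reduced triple, as an inner median. -/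
def imUpperReduce (L : Type*) [Lattice L] : IM L :=
  ⟨fun x => upperMedian (reduce x), isMedian_upperMedian_reduce,
    upperTerm ((var 0).meet ((var 1).join (var 2))) ((var 1).meet ((var 0).join (var 2)))
      ((var 2).meet ((var 0).join (var 1))), rfl⟩

/-! ### The T-poset -/

theorem range_vec_three {α : Type*} (x y z : α) : Set.range ![x, y, z] = {x, y, z} := by
  ext u
  simp [-Matrix.range_cons, Fin.exists_fin_succ, eq_comm]

/-- The triples `t` represent the elements of the T-poset, each of them once. -/
structure Represents (t : Fin k → Fin 3 → L) : Prop where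
  covers : Covers t
  injective : ∀ i, Function.Injective (t i)
  ne : ∀ i, lowerMedian (t i) ≠ upperMedian (t i)
  antisymm : ∀ i j, PermLE (t i) (t j) → PermLE (t j) (t i) → i = j

theorem permittedInterval_nontrivial_iff (x : Fin 3 → L) :
    (permittedInterval x).Nontrivial ↔ lowerMedian x ≠ upperMedian x := by
  constructor
  · rintro ⟨a, ha, b, hb, hab⟩ h
    rw [permittedInterval, h, Set.Icc_self] at ha hb
    exact hab (ha.trans hb.symm)
  · exact fun h => ⟨_, Set.left_mem_Icc.2 (lowerMedian_le_upperMedian x), _,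
      Set.right_mem_Icc.2 (lowerMedian_le_upperMedian x), h⟩

/-- The element of the T-poset that is represented by the `i`-th triple. -/
def Represents.node (ht : Represents t) (i : Fin k) : TPoset L :=
  ⟨Set.range (t i), t i, ht.injective i, rfl, (permittedInterval_nontrivial_iff _).2 (ht.ne i)⟩

theorem Represents.node_surjective (ht : Represents t) : Function.Surjective ht.node := by
  rintro ⟨S, x, hinj, rfl, hx⟩
  obtain ⟨i, σ, rfl⟩ := (ht.covers x).resolve_left ((permittedInterval_nontrivial_iff _).1 hx)
  refine ⟨i, TPoset.ext ?_⟩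
  exact (EquivLike.range_comp (t i) σ).symm

theorem Represents.node_le_iff (ht : Represents t) (i j : Fin k) :
    ht.node i ≤ ht.node j ↔ PermLE (t i) (t j) := by
  let ei := Equiv.ofInjective (t i) (ht.injective i)
  let ej := Equiv.ofInjective (t j) (ht.injective j)
  constructor
  · rintro ⟨e, he⟩
    change Set.range (t i) ≃ Set.range (t j) at e
    refine ⟨((ei.trans e).trans ej.symm).symm, fun l => ?_⟩
    have h := he (e.symm (ej l))
    have h' : ((e (e.symm (ej l)) : Set.range (t j)) : L) = t j l := by
      rw [e.apply_symm_apply]; rfl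
    refine le_trans (le_of_eq ?_) (h.trans h'.le)
    exact congrArg Subtype.val (ei.apply_symm_apply (e.symm (ej l)))
  · rintro ⟨σ, h⟩
    refine ⟨(ei.symm.trans σ.symm).trans ej, ?_⟩
    rintro ⟨-, l, rfl⟩
    have h1 : ei.symm ⟨t i l, l, rfl⟩ = l := ei.symm_apply_apply l
    change t i l ≤ t j (σ.symm (ei.symm ⟨t i l, l, rfl⟩))
    rw [h1]
    simpa using h (σ.symm l)

theorem Represents.node_injective (ht : Represents t) : Function.Injective ht.node :=
  fun i j h => ht.antisymm i j ((ht.node_le_iff i j).1 h.le) ((ht.node_le_iff j i).1 h.ge)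

theorem Represents.node_covBy_iff (ht : Represents t) (i j : Fin k) :
    ht.node i ⋖ ht.node j ↔ (PermLE (t i) (t j) ∧ i ≠ j) ∧
      ∀ l, PermLE (t i) (t l) → PermLE (t l) (t j) → l = i ∨ l = j := by
  have hlt : ∀ i j, ht.node i < ht.node j ↔ PermLE (t i) (t j) ∧ i ≠ j := fun i j => by
    rw [lt_iff_le_and_ne, ht.node_le_iff, ht.node_injective.ne_iff]
  rw [covBy_iff_lt_and_eq_or_eq, hlt, ht.node_surjective.forall]
  simp only [ht.node_le_iff, ht.node_injective.eq_iff]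

/-- The Hasse diagram of the T-poset, computed with representative triples. -/
theorem Represents.hasTPoset (ht : Represents t) (E : Finset (Fin k × Fin k))
    (hE : ∀ i j, (i, j) ∈ E ↔ (PermLE (t i) (t j) ∧ i ≠ j) ∧
      ∀ l, PermLE (t i) (t l) → PermLE (t l) (t j) → l = i ∨ l = j)
    {nodes : Set (Set L)} {edges : Set (Set L × Set L)}
    (hnodes : nodes = Set.range fun i => Set.range (t i))
    (hedges : edges = (fun p : Fin k × Fin k => (Set.range (t p.1), Set.range (t p.2))) '' E) :
    HasTPoset L nodes edges := by
  refine ⟨?_, ?_⟩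
  · rw [hnodes, ← ht.node_surjective.range_comp]
    rfl
  · rw [ht.node_surjective.forall₂]
    intro i j
    rw [ht.node_covBy_iff, ← hE, hedges]
    refine ⟨fun h => ⟨(i, j), h, rfl⟩, ?_⟩
    rintro ⟨⟨i', j'⟩, h, heq⟩
    have h1 := (Prod.ext_iff.1 heq).1
    have h2 := (Prod.ext_iff.1 heq).2
    have hi : i' = i := ht.node_injective (TPoset.ext h1)
    have hj : j' = j := ht.node_injective (TPoset.ext h2)
    subst hi hj
    exact h

/-! ### Distributive lattices -/

theorem Distributive.lowerMedian_eq (hL : Distributive L) (x : Fin 3 → L) :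
    lowerMedian x = upperMedian x := by
  let _ : DistribLattice L := DistribLattice.ofInfSupLe fun a b c => (hL a b c).le
  refine le_antisymm (lowerMedian_le_upperMedian x) ?_
  change (x 0 ⊔ x 1) ⊓ (x 0 ⊔ x 2) ⊓ (x 1 ⊔ x 2) ≤ (x 0 ⊓ x 1) ⊔ (x 0 ⊓ x 2) ⊔ (x 1 ⊓ x 2)
  rw [← sup_inf_left, hL _ (x 1) (x 2)]
  refine sup_le ?_ ?_
  · rw [inf_comm, hL]
    exact sup_le (le_sup_of_le_left (le_sup_of_le_left (inf_comm _ _).le))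
      (le_sup_of_le_right inf_le_right)
  · rw [inf_comm, hL]
    exact sup_le (le_sup_of_le_left (le_sup_of_le_right (inf_comm _ _).le))
      (le_sup_of_le_right (inf_le_right))

theorem Distributive.covers (hL : Distributive L) : Covers (Fin.elim0 : Fin 0 → Fin 3 → L) :=
  fun x => .inl (hL.lowerMedian_eq x)

theorem Distributive.isEmpty_TPoset (hL : Distributive L) : IsEmpty (TPoset L) := by
  refine ⟨?_⟩
  rintro ⟨S, x, -, -, hx⟩
  exact (permittedInterval_nontrivial_iff x).1 hx (hL.lowerMedian_eq x)

theorem Distributive.nonempty_OM (hL : Distributive L) : Nonempty (OM L ≃o Fin 1) := by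
  obtain ⟨e, -⟩ := exists_orderIso_OM hL.covers (fun _ : Fin 1 => Fin.elim0)
    (fun p q => by simp [Subsingleton.elim p q]) (fun _ => ⟨nofun, nofun, nofun⟩)
    (fun g _ => ⟨0, nofun⟩)
  exact ⟨e.symm⟩

theorem Distributive.nonempty_IM (hL : Distributive L) : Nonempty (IM L ≃o Fin 1) :=
  nonempty_orderIso_IM hL.covers (fun _ => imLower L) []
    (fun p q => by simp [Subsingleton.elim p q]) nofun (fun _ _ _ => ⟨0, nofun⟩)

theorem Represents.not_distributive {t : Fin (k + 1) → Fin 3 → L} (ht : Represents t) :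
    ¬ Distributive L :=
  fun hL => hL.isEmpty_TPoset.false (ht.node 0)

end General

/-! ### The medians of `M3` -/

/-- The triples of `M3` with a nontrivial permitted interval. -/
def M3.triples : Fin 1 → Fin 3 → M3 :=
  ![![.a, .b, .c]]

theorem M3.represents : Represents M3.triples :=
  ⟨covers_of_forall (by decide +kernel), by decide +kernel, by decide +kernel, by decide +kernel⟩

theorem M3.hasTPoset :
    HasTPoset M3 {{.a, .b, .c}}
      ∅ :=
  M3.represents.hasTPoset ∅ (by decide +kernel)
    (by ext; simp [-Matrix.range_cons, M3.triples, range_vec_three])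
    (by simp)

/-- The values of the medians of `M3` at the triples `M3.triples`. -/
def M3.omValues : M3 → Fin 1 → M3 :=
  fun p => ![p]

theorem M3.nonempty_OM : Nonempty (OM M3 ≃o M3) := by
  obtain ⟨e, -⟩ := exists_orderIso_OM M3.represents.covers M3.omValues
    (by decide +kernel) (by decide +kernel) (by decide +kernel)
  exact ⟨e.symm⟩

/-- The cyclic automorphism `a ↦ b ↦ c ↦ a` fixes the value at `abc`, which is therefore a bound. -/
theorem M3.nonempty_IM : Nonempty (IM M3 ≃o Fin 2) :=
  nonempty_orderIso_IM M3.represents.covers (![imLower M3, imUpper M3])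
    [(0, 0, [(.bot, .bot), (.a, .b), (.b, .c), (.c, .a), (.top, .top)])]
    (by decide +kernel) (by decide +kernel) (by decide +kernel)

/-! ### The medians of `N5` -/

/-- The triples of `N5` with a nontrivial permitted interval. -/
def N5.triples : Fin 1 → Fin 3 → N5 :=
  ![![.a, .b, .c]]

theorem N5.represents : Represents N5.triples :=
  ⟨covers_of_forall (by decide +kernel), by decide +kernel, by decide +kernel, by decide +kernel⟩

theorem N5.hasTPoset :
    HasTPoset N5 {{.a, .b, .c}}
      ∅ :=
  N5.represents.hasTPoset ∅ (by decide +kernel)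
    (by ext; simp [-Matrix.range_cons, N5.triples, range_vec_three])
    (by simp)

/-- The values of the medians of `N5` at the triples `N5.triples`. -/
def N5.omValues : Fin 2 → Fin 1 → N5 :=
  fun p => ![![.a, .c] p]

theorem N5.nonempty_OM : Nonempty (OM N5 ≃o Fin 2) := by
  obtain ⟨e, -⟩ := exists_orderIso_OM N5.represents.covers N5.omValues
    (by decide +kernel) (by decide +kernel) (by decide +kernel)
  exact ⟨e.symm⟩

/-- Both medians of `N5` are inner, so no relation is needed. -/
theorem N5.nonempty_IM : Nonempty (IM N5 ≃o Fin 2) :=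
  nonempty_orderIso_IM N5.represents.covers (![imLower N5, imUpper N5])
    []
    (by decide +kernel) (by decide +kernel) (by decide +kernel)

/-! ### The medians of `M4` -/

/-- The triples of `M4` with a nontrivial permitted interval. -/
def M4.triples : Fin 4 → Fin 3 → M4 :=
  ![![.a, .b, .c], ![.a, .b, .d], ![.a, .c, .d], ![.b, .c, .d]]

theorem M4.represents : Represents M4.triples :=
  ⟨covers_of_forall (by decide +kernel), by decide +kernel, by decide +kernel, by decide +kernel⟩

theorem M4.hasTPoset :
    HasTPoset M4 {{.a, .b, .c}, {.a, .b, .d}, {.a, .c, .d}, {.b, .c, .d}}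
      ∅ :=
  M4.represents.hasTPoset ∅ (by decide +kernel)
    (by ext; simp [-Matrix.range_cons, M4.triples, range_vec_three,
      Fin.exists_fin_succ, eq_comm])
    (by simp)

theorem M4.nonempty_OM : Nonempty (OM M4 ≃o (Fin 4 → M4)) := by
  obtain ⟨e, -⟩ := exists_orderIso_OM (P := Fin 4 → M4) M4.represents.covers id
    (fun _ _ => Iff.rfl)
    -- every permitted interval is `M4`, and the four triples are pairwise incomparable
    (fun g => ⟨fun i => (by decide +kernel : ∀ i v, lowerMedian (M4.triples i) ≤ v) i _,
      fun i => (by decide +kernel : ∀ i v, v ≤ upperMedian (M4.triples i)) i _, fun i j h => by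
        rw [(by decide +kernel : ∀ i j, PermLE (M4.triples i) (M4.triples j) → i = j) i j h]⟩)
    (fun g _ => ⟨g, fun _ => rfl⟩)
  exact ⟨e.symm⟩

/-- As in `M3`, the value at `abc` is a bound. Isomorphisms between the sublattices generated by
three atoms carry it to the other triples. -/
theorem M4.nonempty_IM : Nonempty (IM M4 ≃o Fin 2) :=
  nonempty_orderIso_IM M4.represents.covers (![imLower M4, imUpper M4])
    [(0, 0, [(.bot, .bot), (.a, .b), (.b, .c), (.c, .a), (.top, .top)]),
      (0, 1, [(.bot, .bot), (.a, .a), (.b, .b), (.c, .d), (.top, .top)]),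
      (0, 2, [(.bot, .bot), (.a, .a), (.b, .c), (.c, .d), (.top, .top)]),
      (0, 3, [(.bot, .bot), (.a, .b), (.b, .c), (.c, .d), (.top, .top)])]
    (by decide +kernel) (by decide +kernel) (by decide +kernel)

/-! ### The medians of `A1` -/

/-- The triples of `A1` with a nontrivial permitted interval. -/
def A1.triples : Fin 4 → Fin 3 → A1 :=
  ![![.a, .b, .c], ![.a, .c, .d], ![.a, .b, .d], ![.b, .c, .d]]

theorem A1.represents : Represents A1.triples :=
  ⟨covers_of_forall (by decide +kernel), by decide +kernel, by decide +kernel, by decide +kernel⟩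

theorem A1.hasTPoset :
    HasTPoset A1 {{.a, .b, .c}, {.a, .c, .d}, {.a, .b, .d}, {.b, .c, .d}}
      {({.a, .b, .d}, {.b, .c, .d})} :=
  A1.represents.hasTPoset {(2, 3)} (by decide +kernel)
    (by ext; simp [-Matrix.range_cons, A1.triples, range_vec_three,
      Fin.exists_fin_succ, eq_comm])
    (by simp [-Matrix.range_cons, A1.triples, range_vec_three])

/-- The values of the medians of `A1` at the triples `A1.triples`. -/
def A1.omValues : (Fin 2 × Fin 2) × {q : A1 × A1 // q.1 ≤ q.2} → Fin 4 → A1 :=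
  fun p =>
    ![![.a, .c] p.1.1, ![.a, .c] p.1.2, p.2.1.1, p.2.1.2]

/-- Monotone maps from the two-element chain, as comparable pairs. -/
def orderHomFinTwo (L : Type*) [Lattice L] : (Fin 2 →o L) ≃o {q : L × L // q.1 ≤ q.2} where
  toFun f := ⟨(f 0, f 1), f.monotone (Fin.zero_le 1)⟩
  invFun q := ⟨![q.1.1, q.1.2], fun i j h => by
    fin_cases i <;> fin_cases j
    · exact le_rfl
    · exact q.2
    · exact absurd h (by decide)
    · exact le_rfl⟩
  left_inv f := by
    ext i
    fin_cases i <;> rfl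
  right_inv q := rfl
  map_rel_iff' {f g} := by
    refine ⟨fun h i => ?_, fun h => ⟨h 0, h 1⟩⟩
    fin_cases i
    exacts [h.1, h.2]

theorem A1.nonempty_OM_pairs :
    Nonempty (OM A1 ≃o (Fin 2 × Fin 2) × {q : A1 × A1 // q.1 ≤ q.2}) := by
  obtain ⟨e, -⟩ := exists_orderIso_OM A1.represents.covers A1.omValues
    (by decide +kernel) (by decide +kernel) (by decide +kernel)
  exact ⟨e.symm⟩

theorem A1.nonempty_OM : Nonempty (OM A1 ≃o (Fin 2 × Fin 2) × (Fin 2 →o A1)) := by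
  obtain ⟨e⟩ := A1.nonempty_OM_pairs
  exact ⟨e.trans
    { toEquiv := (Equiv.refl _).prodCongr (orderHomFinTwo A1).symm.toEquiv
      map_rel_iff' := fun {p q} => and_congr Iff.rfl (orderHomFinTwo A1).symm.le_iff_le }⟩

theorem A1.card_OM : Nat.card (OM A1) = 64 := by
  obtain ⟨e⟩ := A1.nonempty_OM_pairs
  rw [Nat.card_congr e.toEquiv, Nat.card_eq_fintype_card]
  decide +kernel

/-- Two isomorphisms, between pentagons that contain `a` and `c` and between diamonds, leave one
value for `abc` and `acd` and one for `abd` and `bcd`. The latter is a bound, by the cyclic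
automorphism of the diamond on `a`, `b`, `d`. -/
theorem A1.nonempty_IM : Nonempty (IM A1 ≃o Fin 2 × Fin 2) :=
  nonempty_orderIso_IM A1.represents.covers
    (fun p => ![![imLower A1, imUpperReduce A1], ![imLowerRaise A1, imUpper A1]] p.1 p.2)
    [(0, 1, [(.bot, .bot), (.a, .a), (.b, .d), (.c, .c), (.top, .top)]),
      (2, 2, [(.bot, .bot), (.a, .b), (.b, .d), (.d, .a), (.top, .top)]),
      (2, 3, [(.bot, .bot), (.a, .c), (.b, .b), (.d, .d), (.top, .top)])]
    (by decide +kernel) (by decide +kernel) (by decide +kernel)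

/-! ### The medians of `A2` -/

/-- The triples of `A2` with a nontrivial permitted interval. -/
def A2.triples : Fin 4 → Fin 3 → A2 :=
  ![![.a, .b, .c], ![.a, .c, .d], ![.a, .b, .d], ![.b, .c, .d]]

theorem A2.represents : Represents A2.triples :=
  ⟨covers_of_forall (by decide +kernel), by decide +kernel, by decide +kernel, by decide +kernel⟩

theorem A2.hasTPoset :
    HasTPoset A2 {{.a, .b, .c}, {.a, .c, .d}, {.a, .b, .d}, {.b, .c, .d}}
      {({.a, .b, .c}, {.a, .c, .d}), ({.a, .b, .d}, {.b, .c, .d})} :=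
  A2.represents.hasTPoset {(0, 1), (2, 3)} (by decide +kernel)
    (by ext; simp [-Matrix.range_cons, A2.triples, range_vec_three,
      Fin.exists_fin_succ, eq_comm])
    (by simp [-Matrix.range_cons, A2.triples, range_vec_three, Set.image_insert_eq])

/-- The values of the medians of `A2` at the triples `A2.triples`. -/
def A2.omValues : Fin 3 × Fin 3 → Fin 4 → A2 :=
  fun p =>
    ![![.a, .a, .c] p.1, ![.a, .c, .c] p.1, ![.b, .b, .d] p.2, ![.b, .d, .d] p.2]

theorem A2.nonempty_OM : Nonempty (OM A2 ≃o Fin 3 × Fin 3) := by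
  obtain ⟨e, -⟩ := exists_orderIso_OM A2.represents.covers A2.omValues
    (by decide +kernel) (by decide +kernel) (by decide +kernel)
  exact ⟨e.symm⟩

/-- The automorphism of `A2` and an isomorphism between two of its pentagons make the value at `abc`
determine the others. -/
theorem A2.nonempty_IM : Nonempty (IM A2 ≃o Fin 2) :=
  nonempty_orderIso_IM A2.represents.covers (![imLower A2, imUpper A2])
    [(0, 2, [(.bot, .bot), (.a, .b), (.b, .a), (.c, .d), (.d, .c), (.top, .top)]),
      (1, 3, [(.bot, .bot), (.a, .b), (.b, .a), (.c, .d), (.d, .c), (.top, .top)]),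
      (0, 1, [(.bot, .bot), (.a, .a), (.b, .d), (.c, .c), (.top, .top)])]
    (by decide +kernel) (by decide +kernel) (by decide +kernel)

/-! ### The medians of `A3` -/

/-- The triples of `A3` with a nontrivial permitted interval. -/
def A3.triples : Fin 3 → Fin 3 → A3 :=
  ![![.a, .b, .c], ![.a, .b, .d], ![.b, .c, .d]]

theorem A3.represents : Represents A3.triples :=
  ⟨covers_of_forall (by decide +kernel), by decide +kernel, by decide +kernel, by decide +kernel⟩

theorem A3.hasTPoset :
    HasTPoset A3 {{.a, .b, .c}, {.a, .b, .d}, {.b, .c, .d}}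
      {({.a, .b, .c}, {.a, .b, .d}), ({.a, .b, .d}, {.b, .c, .d})} :=
  A3.represents.hasTPoset {(0, 1), (1, 2)} (by decide +kernel)
    (by ext; simp [-Matrix.range_cons, A3.triples, range_vec_three,
      Fin.exists_fin_succ, eq_comm])
    (by simp [-Matrix.range_cons, A3.triples, range_vec_three, Set.image_insert_eq])

/-- The values at the triples `A3.triples` of the median with a given name. The letters `a`, `b`,
`c` of the name stand for the elements `a`, `c`, `d` of `A3`. -/
def A3.omValues : OMA3Vertex → Fin 3 → A3
  | .aab => ![.a, .a, .c]
  | .aac => ![.a, .a, .d]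
  | .abb => ![.a, .c, .c]
  | .abc => ![.a, .c, .d]
  | .acc => ![.a, .d, .d]
  | .bbb => ![.c, .c, .c]
  | .bbc => ![.c, .c, .d]
  | .bcc => ![.c, .d, .d]

theorem A3.omValues_injective : Function.Injective A3.omValues := by
  intro x y h
  cases x <;> cases y <;> first
    | rfl
    | simp [A3.omValues] at h

instance : DecidableEq OMA3Vertex := A3.omValues_injective.decidableEq

instance : Fintype OMA3Vertex :=
  ⟨{.aab, .aac, .abb, .abc, .acc, .bbb, .bbc, .bcc}, fun x => by cases x <;> decide⟩

/-- The names of the medians of `A3`, ordered by the values of the medians. -/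
instance : PartialOrder OMA3Vertex :=
  PartialOrder.lift A3.omValues A3.omValues_injective

instance : DecidableLE OMA3Vertex := fun x y =>
  inferInstanceAs (Decidable (∀ i, A3.omValues x i ≤ A3.omValues y i))

instance : DecidableLT OMA3Vertex := decidableLTOfDecidableLE

theorem A3.hasHasseDiagram_OM : HasHasseDiagram (OM A3) omA3Edges := by
  obtain ⟨e, -⟩ := exists_orderIso_OM A3.represents.covers A3.omValues
    (fun _ _ => Iff.rfl) (by decide +kernel) (by decide +kernel)
  refine ⟨e.toEquiv, fun i j => ?_⟩
  have h : e.toEquiv i ⋖ e.toEquiv j ↔ i ⋖ j := apply_covBy_apply_iff e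
  rw [h, covBy_iff_lt_and_eq_or_eq]
  simp only [omA3Edges, Set.mem_insert_iff, Set.mem_singleton_iff]
  clear h
  revert i j
  decide +kernel

/-- Isomorphisms between the three pentagons make the value at `abc` determine the others. -/
theorem A3.nonempty_IM : Nonempty (IM A3 ≃o Fin 2) :=
  nonempty_orderIso_IM A3.represents.covers (![imLower A3, imUpper A3])
    [(0, 1, [(.bot, .bot), (.a, .a), (.b, .b), (.c, .d), (.top, .top)]),
      (0, 2, [(.bot, .bot), (.a, .c), (.b, .b), (.c, .d), (.top, .top)])]
    (by decide +kernel) (by decide +kernel) (by decide +kernel)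

/-! ### The medians of `L4` -/

/-- The triples of `L4` with a nontrivial permitted interval. -/
def L4.triples : Fin 3 → Fin 3 → L4 :=
  ![![.a, .b, .c], ![.a, .c, .d], ![.b, .c, .d]]

theorem L4.represents : Represents L4.triples :=
  ⟨covers_of_forall (by decide +kernel), by decide +kernel, by decide +kernel, by decide +kernel⟩

theorem L4.hasTPoset :
    HasTPoset L4 {{.a, .b, .c}, {.a, .c, .d}, {.b, .c, .d}}
      {({.a, .b, .c}, {.a, .c, .d}), ({.a, .b, .c}, {.b, .c, .d})} :=
  L4.represents.hasTPoset {(0, 1), (0, 2)} (by decide +kernel)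
    (by ext; simp [-Matrix.range_cons, L4.triples, range_vec_three,
      Fin.exists_fin_succ, eq_comm])
    (by simp [-Matrix.range_cons, L4.triples, range_vec_three, Set.image_insert_eq])

theorem L4.exists_orderIso_OM : ∃ e : Fin 3 × Fin 3 ≃o OM L4, ∀ i j : Fin 3,
    omL4Label i j = ![(e (i, j)).1 ![.a, .b, .c], (e (i, j)).1 ![.a, .c, .d],
      (e (i, j)).1 ![.b, .c, .d]] := by
  obtain ⟨e, he⟩ := LatticeMedian.exists_orderIso_OM (P := Fin 3 × Fin 3) L4.represents.covers
    (fun p => omL4Label p.1 p.2) (by decide +kernel) (by decide +kernel) (by decide +kernel)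
  refine ⟨e, fun i j => funext fun l => ?_⟩
  fin_cases l
  exacts [(he (i, j) 0).symm, (he (i, j) 1).symm, (he (i, j) 2).symm]

/-- The automorphism of `L4` that swaps `a` and `b` leaves only the values `bot` and `d` at `abc`,
and links the values at `acd` and `bcd`. -/
theorem L4.nonempty_IM : Nonempty (IM L4 ≃o Fin 3) :=
  nonempty_orderIso_IM L4.represents.covers (![imLower L4, imLowerRaise L4, imUpper L4])
    [(0, 0, [(.bot, .bot), (.a, .b), (.b, .a), (.c, .c), (.d, .d), (.top, .top)]),
      (1, 2, [(.bot, .bot), (.a, .b), (.b, .a), (.c, .c), (.d, .d), (.top, .top)])]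
    (by decide +kernel) (by decide +kernel) (by decide +kernel)

/-! ### The medians of `L5` -/

/-- The triples of `L5` with a nontrivial permitted interval. -/
def L5.triples : Fin 3 → Fin 3 → L5 :=
  ![![.a, .b, .c], ![.a, .c, .d], ![.b, .c, .d]]

theorem L5.represents : Represents L5.triples :=
  ⟨covers_of_forall (by decide +kernel), by decide +kernel, by decide +kernel, by decide +kernel⟩

theorem L5.hasTPoset :
    HasTPoset L5 {{.a, .b, .c}, {.a, .c, .d}, {.b, .c, .d}}
      {({.a, .c, .d}, {.a, .b, .c}), ({.b, .c, .d}, {.a, .b, .c})} :=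
  L5.represents.hasTPoset {(1, 0), (2, 0)} (by decide +kernel)
    (by ext; simp [-Matrix.range_cons, L5.triples, range_vec_three,
      Fin.exists_fin_succ, eq_comm])
    (by simp [-Matrix.range_cons, L5.triples, range_vec_three, Set.image_insert_eq])

/-- The values of the medians of `L5` at the triples `L5.triples`. They arise from `omL4Label` by
the duality between `L4` and `L5`, which reverses both coordinates. -/
def L5.omValues : Fin 3 × Fin 3 → Fin 3 → L5 :=
  fun p =>
    ![![![.d, .d, .d], ![.b, .d, .d], ![.b, .d, .b]],
      ![![.a, .d, .d], ![.top, .d, .d], ![.top, .d, .b]],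
      ![![.a, .a, .d], ![.top, .a, .d], ![.top, .a, .b]]] p.1 p.2

theorem L5.nonempty_OM : Nonempty (OM L5 ≃o Fin 3 × Fin 3) := by
  obtain ⟨e, -⟩ := exists_orderIso_OM L5.represents.covers L5.omValues
    (by decide +kernel) (by decide +kernel) (by decide +kernel)
  exact ⟨e.symm⟩

/-- The automorphism of `L5` that swaps `a` and `b` leaves only the values `d` and `top` at `abc`,
and links the values at `acd` and `bcd`. -/
theorem L5.nonempty_IM : Nonempty (IM L5 ≃o Fin 3) :=
  nonempty_orderIso_IM L5.represents.covers (![imLower L5, imUpperReduce L5, imUpper L5])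
    [(0, 0, [(.bot, .bot), (.a, .b), (.b, .a), (.c, .c), (.d, .d), (.top, .top)]),
      (1, 2, [(.bot, .bot), (.a, .b), (.b, .a), (.c, .c), (.d, .d), (.top, .top)])]
    (by decide +kernel) (by decide +kernel) (by decide +kernel)

/-! ### The medians of `B1` -/

/-- The triples of `B1` with a nontrivial permitted interval. -/
def B1.triples : Fin 1 → Fin 3 → B1 :=
  ![![.a, .b, .c]]

theorem B1.represents : Represents B1.triples :=
  ⟨covers_of_forall (by decide +kernel), by decide +kernel, by decide +kernel, by decide +kernel⟩

theorem B1.hasTPoset :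
    HasTPoset B1 {{.a, .b, .c}}
      ∅ :=
  B1.represents.hasTPoset ∅ (by decide +kernel)
    (by ext; simp [-Matrix.range_cons, B1.triples, range_vec_three])
    (by simp)

/-- The values of the medians of `B1` at the triples `B1.triples`. -/
def B1.omValues : M3 → Fin 1 → B1 :=
  fun
    | .bot => ![.bot] | .a => ![.a] | .b => ![.b] | .c => ![.c] | .top => ![.d]

theorem B1.nonempty_OM : Nonempty (OM B1 ≃o M3) := by
  obtain ⟨e, -⟩ := exists_orderIso_OM B1.represents.covers B1.omValues
    (by decide +kernel) (by decide +kernel) (by decide +kernel)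
  exact ⟨e.symm⟩

/-- The cyclic automorphism of `B1` fixes the value at `abc`, which is therefore `bot` or `d`. -/
theorem B1.nonempty_IM : Nonempty (IM B1 ≃o Fin 2) :=
  nonempty_orderIso_IM B1.represents.covers (![imLower B1, imUpper B1])
    [(0, 0, [(.bot, .bot), (.a, .b), (.b, .c), (.c, .a), (.d, .d)])]
    (by decide +kernel) (by decide +kernel) (by decide +kernel)

/-! ### The medians of `B2` -/

/-- The triples of `B2` with a nontrivial permitted interval. -/
def B2.triples : Fin 1 → Fin 3 → B2 :=
  ![![.a, .b, .c]]

theorem B2.represents : Represents B2.triples :=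
  ⟨covers_of_forall (by decide +kernel), by decide +kernel, by decide +kernel, by decide +kernel⟩

theorem B2.hasTPoset :
    HasTPoset B2 {{.a, .b, .c}}
      ∅ :=
  B2.represents.hasTPoset ∅ (by decide +kernel)
    (by ext; simp [-Matrix.range_cons, B2.triples, range_vec_three])
    (by simp)

/-- The values of the medians of `B2` at the triples `B2.triples`. -/
def B2.omValues : M3 → Fin 1 → B2 :=
  fun
    | .bot => ![.d] | .a => ![.a] | .b => ![.b] | .c => ![.c] | .top => ![.top]

theorem B2.nonempty_OM : Nonempty (OM B2 ≃o M3) := by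
  obtain ⟨e, -⟩ := exists_orderIso_OM B2.represents.covers B2.omValues
    (by decide +kernel) (by decide +kernel) (by decide +kernel)
  exact ⟨e.symm⟩

/-- The cyclic automorphism of `B2` fixes the value at `abc`, which is therefore `d` or `top`. -/
theorem B2.nonempty_IM : Nonempty (IM B2 ≃o Fin 2) :=
  nonempty_orderIso_IM B2.represents.covers (![imLower B2, imUpper B2])
    [(0, 0, [(.d, .d), (.a, .b), (.b, .c), (.c, .a), (.top, .top)])]
    (by decide +kernel) (by decide +kernel) (by decide +kernel)

/-! ### The medians of `B3` -/

/-- The triples of `B3` with a nontrivial permitted interval. -/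
def B3.triples : Fin 1 → Fin 3 → B3 :=
  ![![.a, .b, .c]]

theorem B3.represents : Represents B3.triples :=
  ⟨covers_of_forall (by decide +kernel), by decide +kernel, by decide +kernel, by decide +kernel⟩

theorem B3.hasTPoset :
    HasTPoset B3 {{.a, .b, .c}}
      ∅ :=
  B3.represents.hasTPoset ∅ (by decide +kernel)
    (by ext; simp [-Matrix.range_cons, B3.triples, range_vec_three])
    (by simp)

/-- The values of the medians of `B3` at the triples `B3.triples`. -/
def B3.omValues : Fin 2 → Fin 1 → B3 :=
  fun p => ![![.a, .c] p]

theorem B3.nonempty_OM : Nonempty (OM B3 ≃o Fin 2) := by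
  obtain ⟨e, -⟩ := exists_orderIso_OM B3.represents.covers B3.omValues
    (by decide +kernel) (by decide +kernel) (by decide +kernel)
  exact ⟨e.symm⟩

/-- Both medians of `B3` are inner, so no relation is needed. -/
theorem B3.nonempty_IM : Nonempty (IM B3 ≃o Fin 2) :=
  nonempty_orderIso_IM B3.represents.covers (![imLower B3, imUpper B3])
    []
    (by decide +kernel) (by decide +kernel) (by decide +kernel)

/-! ### The medians of `B4` -/

/-- The triples of `B4` with a nontrivial permitted interval. -/
def B4.triples : Fin 1 → Fin 3 → B4 :=
  ![![.a, .b, .c]]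

theorem B4.represents : Represents B4.triples :=
  ⟨covers_of_forall (by decide +kernel), by decide +kernel, by decide +kernel, by decide +kernel⟩

theorem B4.hasTPoset :
    HasTPoset B4 {{.a, .b, .c}}
      ∅ :=
  B4.represents.hasTPoset ∅ (by decide +kernel)
    (by ext; simp [-Matrix.range_cons, B4.triples, range_vec_three])
    (by simp)

/-- The values of the medians of `B4` at the triples `B4.triples`. -/
def B4.omValues : Fin 2 → Fin 1 → B4 :=
  fun p => ![![.c, .a] p]

theorem B4.nonempty_OM : Nonempty (OM B4 ≃o Fin 2) := by
  obtain ⟨e, -⟩ := exists_orderIso_OM B4.represents.covers B4.omValues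
    (by decide +kernel) (by decide +kernel) (by decide +kernel)
  exact ⟨e.symm⟩

/-- Both medians of `B4` are inner, so no relation is needed. -/
theorem B4.nonempty_IM : Nonempty (IM B4 ≃o Fin 2) :=
  nonempty_orderIso_IM B4.represents.covers (![imLower B4, imUpper B4])
    []
    (by decide +kernel) (by decide +kernel) (by decide +kernel)

/-! ### Order matrices -/

/-- The entry of a Boolean matrix, given by the list of its rows. -/
def entry (M : List (List Bool)) (i j : ℕ) : Bool := (M.getD i []).getD j false

/-- The matrix of the order relation between the entries of a list. -/
def leMatrix {α : Type*} [LE α] [DecidableLE α] (l : List α) : List (List Bool) :=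
  l.map fun x => l.map fun y => decide (x ≤ y)

/-- The relation with the `n × n` matrix `M` is transitive and has least upper bounds of pairs. -/
def IsJoinMatrix (n : ℕ) (M : List (List Bool)) : Prop :=
  (∀ i ∈ List.range n, ∀ j ∈ List.range n, ∀ k ∈ List.range n,
    entry M i j → entry M j k → entry M i k) ∧
  ∀ i ∈ List.range n, ∀ j ∈ List.range n, ∃ k ∈ List.range n, entry M i k ∧ entry M j k ∧
    ∀ l ∈ List.range n, entry M i l → entry M j l → entry M k l

instance (n : ℕ) (M : List (List Bool)) : Decidable (IsJoinMatrix n M) :=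
  inferInstanceAs (Decidable (_ ∧ _))

/-- The inequality `x ∧ (y ∨ z) ≤ (x ∧ y) ∨ (x ∧ z)`, in terms of the order with the `n × n`
matrix `M` alone: an element `w` with `w ≤ x` and `w ≤ y ∨ z` is below every `v` with `x ∧ y ≤ v`
and `x ∧ z ≤ v`. -/
def IsDistribMatrix (n : ℕ) (M : List (List Bool)) : Prop :=
  ∀ x ∈ List.range n, ∀ y ∈ List.range n, ∀ z ∈ List.range n, ∀ w ∈ List.range n, entry M w x →
    (∀ u ∈ List.range n, entry M y u → entry M z u → entry M w u) → ∀ v ∈ List.range n,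
      (∀ t ∈ List.range n, entry M t x → entry M t y → entry M t v) →
        (∀ t ∈ List.range n, entry M t x → entry M t z → entry M t v) → entry M w v

instance (n : ℕ) (M : List (List Bool)) : Decidable (IsDistribMatrix n M) := by
  unfold IsDistribMatrix
  infer_instance

/-- `M` is the order matrix of a list that begins with `p`, ends with `q` and permutes `m` in
between. -/
def IsMatrixOf (M : List (List Bool)) {α : Type*} [LE α] [DecidableLE α] (p q : α) (m : List α) :
    Prop :=
  ∃ l ∈ m.permutations', leMatrix (p :: (l ++ [q])) = M

instance (M : List (List Bool)) {α : Type*} [LE α] [DecidableLE α] (p q : α) (m : List α) :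
    Decidable (IsMatrixOf M p q m) :=
  inferInstanceAs (Decidable (∃ l ∈ m.permutations', leMatrix (p :: (l ++ [q])) = M))

section Enumeration

variable {L : Type*} [Lattice L] {n : ℕ}

/-- The elements of `L` are enumerated by `x`, along a linear extension of the order. -/
structure IsLinearEnumeration (x : Fin n ≃ L) : Prop where
  le_of_le : ∀ i j, x i ≤ x j → i ≤ j

theorem exists_isLinearEnumeration [Finite L] (h : Nat.card L = n) :
    ∃ x : Fin n ≃ L, IsLinearEnumeration x := by
  have := Fintype.ofFinite L
  let _ : Fintype (LinearExtension L) := inferInstanceAs (Fintype L)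
  have hc : Fintype.card (LinearExtension L) = n := by
    rw [← h, Nat.card_eq_fintype_card]
    rfl
  let e := Fintype.orderIsoFinOfCardEq (LinearExtension L) hc
  refine ⟨e.toEquiv, ⟨fun i j hij => ?_⟩⟩
  have h : e i ≤ e j := (toLinearExtension (α := L)).monotone hij
  exact e.le_iff_le.1 h

/-- The first and the last element of the enumeration are the least and the greatest element, so
only the comparisons of the elements between them carry information. -/
theorem IsLinearEnumeration.le_iff {x : Fin (n + 1) ≃ L} (hx : IsLinearEnumeration x)
    (i j : Fin (n + 1)) :
    x i ≤ x j ↔ i = 0 ∨ j = Fin.last n ∨ i = j ∨ (i < j ∧ x i ≤ x j) := by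
  constructor
  · intro h
    rcases (hx.le_of_le i j h).eq_or_lt with h' | h'
    · exact .inr (.inr (.inl h'))
    · exact .inr (.inr (.inr ⟨h', h⟩))
  · rintro (rfl | rfl | rfl | h)
    · obtain ⟨k, hk⟩ := x.surjective (Finset.univ.inf' Finset.univ_nonempty x)
      have hk' : ∀ l, x k ≤ x l := fun l => hk.le.trans (Finset.inf'_le _ (Finset.mem_univ l))
      have : k = 0 := le_antisymm (hx.le_of_le _ _ (hk' 0)) (Fin.zero_le _)
      exact this ▸ hk' j
    · obtain ⟨k, hk⟩ := x.surjective (Finset.univ.sup' Finset.univ_nonempty x)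
      have hk' : ∀ l, x l ≤ x k := fun l => (Finset.le_sup' _ (Finset.mem_univ l)).trans hk.ge
      have : k = Fin.last n := le_antisymm (Fin.le_last _) (hx.le_of_le _ _ (hk' _))
      exact this ▸ hk' i
    · exact le_rfl
    · exact h.2

variable {x : Fin n ≃ L} {M : List (List Bool)}

theorem forall_mem_range_iff {p : ℕ → Prop} :
    (∀ i ∈ List.range n, p i) ↔ ∀ i : Fin n, p i := by
  simp only [List.mem_range]
  exact ⟨fun h i => h i i.2, fun h i hi => h ⟨i, hi⟩⟩

theorem exists_mem_range_iff {p : ℕ → Prop} :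
    (∃ i ∈ List.range n, p i) ↔ ∃ i : Fin n, p i := by
  simp only [List.mem_range]
  exact ⟨fun ⟨i, hi, h⟩ => ⟨⟨i, hi⟩, h⟩, fun ⟨i, h⟩ => ⟨i, i.2, h⟩⟩

theorem isJoinMatrix_of_entry (hM : ∀ i j : Fin n, entry M i j ↔ x i ≤ x j) :
    IsJoinMatrix n M := by
  simp only [IsJoinMatrix, forall_mem_range_iff, exists_mem_range_iff, hM]
  refine ⟨fun i j k => le_trans, fun i j => ⟨x.symm (x i ⊔ x j), ?_⟩⟩
  simp only [x.apply_symm_apply]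
  exact ⟨le_sup_left, le_sup_right, fun l => sup_le⟩

theorem IsDistribMatrix.distributive (h : IsDistribMatrix n M)
    (hM : ∀ i j : Fin n, entry M i j ↔ x i ≤ x j) : Distributive L := by
  simp only [IsDistribMatrix, forall_mem_range_iff, hM] at h
  intro a b c
  refine le_antisymm ?_ (sup_le (inf_le_inf_left _ le_sup_left) (inf_le_inf_left _ le_sup_right))
  have h' := h (x.symm a) (x.symm b) (x.symm c) (x.symm (a ⊓ (b ⊔ c)))
  simp only [x.apply_symm_apply] at h'
  have h'' := h' inf_le_left (fun u hb hc => inf_le_right.trans (sup_le hb hc))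
    (x.symm (a ⊓ b ⊔ a ⊓ c))
  simp only [x.apply_symm_apply] at h''
  exact h'' (fun t ha hb => (le_inf ha hb).trans le_sup_left)
    (fun t ha hc => (le_inf ha hc).trans le_sup_right)

theorem entry_leMatrix {α : Type*} [LE α] [DecidableLE α] (l : List α) (i j : Fin l.length) :
    entry (leMatrix l) i j ↔ l[i] ≤ l[j] := by
  simp [entry, leMatrix]

theorem IsMatrixOf.nonempty_orderIso {α : Type*} [Lattice α] [DecidableLE α] {p q : α}
    {m : List α} (h : IsMatrixOf M p q m) (hM : ∀ i j : Fin n, entry M i j ↔ x i ≤ x j)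
    (hn : M.length = n) [Finite α] (hα : Nat.card α = n) : Nonempty (L ≃o α) := by
  obtain ⟨l, -, rfl⟩ := h
  generalize p :: (l ++ [q]) = l at *
  have hl : l.length = n := by simpa [leMatrix] using hn
  subst hl
  let e : L ↪o α := OrderEmbedding.ofMapLEIff (fun y => l[x.symm y]) fun y z => by
    rw [← entry_leMatrix, hM, x.apply_symm_apply, x.apply_symm_apply]
  have hb : Function.Bijective e := by
    have := Finite.of_equiv _ x
    refine (Nat.bijective_iff_injective_and_card e).2 ⟨e.injective, ?_⟩
    rw [hα, ← Nat.card_congr x, Nat.card_fin]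
  exact ⟨RelIso.ofSurjective e hb.2⟩

end Enumeration

/-! ### Lattices with at most six elements -/

/-- The order matrix of a five-element lattice along a linear extension. -/
def matrix5 (a b c : Bool) : List (List Bool) :=
  [[true, true, true, true, true], [false, true, a, b, true], [false, false, true, c, true],
    [false, false, false, true, true], [false, false, false, false, true]]

/-- The order matrix of a six-element lattice along a linear extension. -/
def matrix6 (a b c d e f : Bool) : List (List Bool) :=
  [[true, true, true, true, true, true], [false, true, a, b, c, true],
    [false, false, true, d, e, true], [false, false, false, true, f, true],
    [false, false, false, false, true, true], [false, false, false, false, false, true]]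

theorem matrix5_cases : ∀ a b c, IsJoinMatrix 5 (matrix5 a b c) →
    IsMatrixOf (matrix5 a b c) M3.bot M3.top [.a, .b, .c] ∨
    IsMatrixOf (matrix5 a b c) N5.bot N5.top [.a, .b, .c] ∨
    IsDistribMatrix 5 (matrix5 a b c) := by
  decide +kernel

theorem matrix6_cases : ∀ a b c d e f, IsJoinMatrix 6 (matrix6 a b c d e f) →
    IsMatrixOf (matrix6 a b c d e f) M4.bot M4.top [.a, .b, .c, .d] ∨
    IsMatrixOf (matrix6 a b c d e f) A1.bot A1.top [.a, .b, .c, .d] ∨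
    IsMatrixOf (matrix6 a b c d e f) A2.bot A2.top [.a, .b, .c, .d] ∨
    IsMatrixOf (matrix6 a b c d e f) A3.bot A3.top [.a, .b, .c, .d] ∨
    IsMatrixOf (matrix6 a b c d e f) L4.bot L4.top [.a, .b, .c, .d] ∨
    IsMatrixOf (matrix6 a b c d e f) L5.bot L5.top [.a, .b, .c, .d] ∨
    IsMatrixOf (matrix6 a b c d e f) B1.bot B1.top [.a, .b, .c, .d] ∨
    IsMatrixOf (matrix6 a b c d e f) B2.bot B2.top [.a, .b, .c, .d] ∨
    IsMatrixOf (matrix6 a b c d e f) B3.bot B3.top [.a, .b, .c, .d] ∨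
    IsMatrixOf (matrix6 a b c d e f) B4.bot B4.top [.a, .b, .c, .d] ∨
    IsDistribMatrix 6 (matrix6 a b c d e f) := by
  decide +kernel

/-- Every lattice with at most six elements that is not distributive occurs in the table. -/
theorem exists_tableName {L : Type*} [Lattice L] [Finite L] (hcard : Nat.card L ≤ 6)
    (hL : ¬ Distributive L) : ∃ n : TableName, Nonempty (L ≃o n.Carrier) := by
  classical
  obtain ⟨n, hn⟩ : ∃ n, Nat.card L = n := ⟨_, rfl⟩
  obtain ⟨x, hx⟩ := exists_isLinearEnumeration hn
  rw [hn] at hcard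
  interval_cases n
  · exact absurd (fun a => (x.symm a).elim0) hL
  · refine absurd (IsDistribMatrix.distributive (n := 1) (M := [[true]]) (x := x) (by decide)
      fun i j => ?_) hL
    rw [hx.le_iff i j]
    fin_cases i
    fin_cases j
    simp [entry]
  · refine absurd (IsDistribMatrix.distributive (n := 2) (M := [[true, true], [false, true]])
      (x := x) (by decide) fun i j => ?_) hL
    rw [hx.le_iff i j]
    fin_cases i <;> fin_cases j <;> simp [entry]
  · refine absurd (IsDistribMatrix.distributive (n := 3) (x := x)
      (M := [[true, true, true], [false, true, true], [false, false, true]])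
      (by decide +kernel) fun i j => ?_) hL
    rw [hx.le_iff i j]
    fin_cases i <;> fin_cases j <;> simp [entry, Fin.ext_iff]
  · refine absurd (IsDistribMatrix.distributive (n := 4) (x := x)
      (M := [[true, true, true, true], [false, true, decide (x 1 ≤ x 2), true],
        [false, false, true, true], [false, false, false, true]])
      ?_ fun i j => ?_) hL
    · generalize decide (x 1 ≤ x 2) = a
      revert a
      decide +kernel
    · rw [hx.le_iff i j]
      fin_cases i <;> fin_cases j <;> simp [entry, Fin.ext_iff]
  · have hM : ∀ i j : Fin 5, entry (matrix5 (x 1 ≤ x 2) (x 1 ≤ x 3) (x 2 ≤ x 3)) i j ↔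
        x i ≤ x j := fun i j => by
      rw [hx.le_iff i j]
      fin_cases i <;> fin_cases j <;> simp [entry, matrix5, Fin.ext_iff]
    rcases matrix5_cases _ _ _ (isJoinMatrix_of_entry hM) with h | h | h
    · exact ⟨.M3, h.nonempty_orderIso hM rfl (Nat.card_eq_fintype_card.trans rfl)⟩
    · exact ⟨.N5, h.nonempty_orderIso hM rfl (Nat.card_eq_fintype_card.trans rfl)⟩
    · exact absurd (h.distributive hM) hL
  · have hM : ∀ i j : Fin 6, entry (matrix6 (x 1 ≤ x 2) (x 1 ≤ x 3) (x 1 ≤ x 4) (x 2 ≤ x 3)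
        (x 2 ≤ x 4) (x 3 ≤ x 4)) i j ↔ x i ≤ x j := fun i j => by
      rw [hx.le_iff i j]
      fin_cases i <;> fin_cases j <;> simp [entry, matrix6, Fin.ext_iff]
    rcases matrix6_cases _ _ _ _ _ _ (isJoinMatrix_of_entry hM) with
      h | h | h | h | h | h | h | h | h | h | h
    · exact ⟨.M4, h.nonempty_orderIso hM rfl (Nat.card_eq_fintype_card.trans rfl)⟩
    · exact ⟨.A1, h.nonempty_orderIso hM rfl (Nat.card_eq_fintype_card.trans rfl)⟩
    · exact ⟨.A2, h.nonempty_orderIso hM rfl (Nat.card_eq_fintype_card.trans rfl)⟩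
    · exact ⟨.A3, h.nonempty_orderIso hM rfl (Nat.card_eq_fintype_card.trans rfl)⟩
    · exact ⟨.L4, h.nonempty_orderIso hM rfl (Nat.card_eq_fintype_card.trans rfl)⟩
    · exact ⟨.L5, h.nonempty_orderIso hM rfl (Nat.card_eq_fintype_card.trans rfl)⟩
    · exact ⟨.B1, h.nonempty_orderIso hM rfl (Nat.card_eq_fintype_card.trans rfl)⟩
    · exact ⟨.B2, h.nonempty_orderIso hM rfl (Nat.card_eq_fintype_card.trans rfl)⟩
    · exact ⟨.B3, h.nonempty_orderIso hM rfl (Nat.card_eq_fintype_card.trans rfl)⟩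
    · exact ⟨.B4, h.nonempty_orderIso hM rfl (Nat.card_eq_fintype_card.trans rfl)⟩
    · exact absurd (h.distributive hM) hL

/-! ### The lattices of the table are pairwise nonisomorphic -/

/-- The numbers of triples `(x, y, z)` with `x ≤ y, z` and with `y, z ≤ x`: an isomorphism
invariant that separates the lattices of the table. -/
noncomputable def profile (L : Type*) [LE L] : ℕ × ℕ :=
  (Nat.card {p : L × L × L // p.1 ≤ p.2.1 ∧ p.1 ≤ p.2.2},
    Nat.card {p : L × L × L // p.2.1 ≤ p.1 ∧ p.2.2 ≤ p.1})

theorem profile_congr {L K : Type*} [Lattice L] [Lattice K] (e : L ≃o K) :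
    profile L = profile K := by
  let e' : L × L × L ≃ K × K × K := e.toEquiv.prodCongr (e.toEquiv.prodCongr e.toEquiv)
  exact Prod.ext
    (Nat.card_congr (e'.subtypeEquiv fun p => and_congr e.le_iff_le.symm e.le_iff_le.symm))
    (Nat.card_congr (e'.subtypeEquiv fun p => and_congr e.le_iff_le.symm e.le_iff_le.symm))

/-- The profile of the lattice with a given name. -/
def TableName.profile : TableName → ℕ × ℕ
  | .M3 => (38, 38)
  | .N5 => (43, 43)
  | .M4 => (53, 53)
  | .A1 => (58, 58)
  | .A2 => (63, 63)
  | .A3 => (70, 70)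
  | .L4 => (63, 65)
  | .L5 => (65, 63)
  | .B1 => (68, 74)
  | .B2 => (74, 68)
  | .B3 => (75, 79)
  | .B4 => (79, 75)

theorem profile_eq {L : Type*} [LE L] [DecidableLE L] [Fintype L] {u d : ℕ}
    (hu : Fintype.card {p : L × L × L // p.1 ≤ p.2.1 ∧ p.1 ≤ p.2.2} = u)
    (hd : Fintype.card {p : L × L × L // p.2.1 ≤ p.1 ∧ p.2.2 ≤ p.1} = d) :
    profile L = (u, d) :=
  Prod.ext (Nat.card_eq_fintype_card.trans hu) (Nat.card_eq_fintype_card.trans hd)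

theorem TableName.profile_carrier (n : TableName) :
    LatticeMedian.profile n.Carrier = n.profile := by
  cases n
  · exact profile_eq (L := LatticeMedian.M3) (by decide +kernel) (by decide +kernel)
  · exact profile_eq (L := LatticeMedian.N5) (by decide +kernel) (by decide +kernel)
  · exact profile_eq (L := LatticeMedian.M4) (by decide +kernel) (by decide +kernel)
  · exact profile_eq (L := LatticeMedian.A1) (by decide +kernel) (by decide +kernel)
  · exact profile_eq (L := LatticeMedian.A2) (by decide +kernel) (by decide +kernel)
  · exact profile_eq (L := LatticeMedian.A3) (by decide +kernel) (by decide +kernel)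
  · exact profile_eq (L := LatticeMedian.L4) (by decide +kernel) (by decide +kernel)
  · exact profile_eq (L := LatticeMedian.L5) (by decide +kernel) (by decide +kernel)
  · exact profile_eq (L := LatticeMedian.B1) (by decide +kernel) (by decide +kernel)
  · exact profile_eq (L := LatticeMedian.B2) (by decide +kernel) (by decide +kernel)
  · exact profile_eq (L := LatticeMedian.B3) (by decide +kernel) (by decide +kernel)
  · exact profile_eq (L := LatticeMedian.B4) (by decide +kernel) (by decide +kernel)

theorem TableName.profile_injective : Function.Injective TableName.profile := by
  intro n m h
  cases n <;> cases m <;> first | rfl | simp [TableName.profile] at h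

theorem TableName.eq_of_orderIso {n m : TableName} (e : n.Carrier ≃o m.Carrier) : n = m :=
  profile_injective (by rw [← profile_carrier, ← profile_carrier, profile_congr e])

end LatticeMedian

theorem mainTheorem2 :
    -- every lattice with at most six elements is distributive or exactly one lattice of the table
    (∀ (L : Type*) [Lattice L] [Finite L], Nat.card L ≤ 6 →
      (Distributive L →
        IsEmpty (TPoset L) ∧ Nonempty (OM L ≃o Fin 1) ∧ Nonempty (IM L ≃o Fin 1)) ∧
      (¬ Distributive L → ∃! n : TableName, Nonempty (L ≃o n.Carrier))) ∧
    (∀ n : TableName, ¬ Distributive n.Carrier) ∧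
    -- the rows of the table
    (HasTPoset M3 {{.a, .b, .c}}
        ∅ ∧
      Nonempty (OM M3 ≃o M3) ∧ Nonempty (IM M3 ≃o Fin 2)) ∧
    (HasTPoset N5 {{.a, .b, .c}}
        ∅ ∧
      Nonempty (OM N5 ≃o Fin 2) ∧ Nonempty (IM N5 ≃o Fin 2)) ∧
    (HasTPoset M4 {{.a, .b, .c}, {.a, .b, .d}, {.a, .c, .d}, {.b, .c, .d}}
        ∅ ∧
      Nonempty (OM M4 ≃o (Fin 4 → M4)) ∧ Nonempty (IM M4 ≃o Fin 2)) ∧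
    (HasTPoset A1 {{.a, .b, .c}, {.a, .c, .d}, {.a, .b, .d}, {.b, .c, .d}}
        {({.a, .b, .d}, {.b, .c, .d})} ∧
      Nonempty (OM A1 ≃o (Fin 2 × Fin 2) × (Fin 2 →o A1)) ∧ Nat.card (OM A1) = 64 ∧ Nonempty (IM A1 ≃o Fin 2 × Fin 2)) ∧
    (HasTPoset A2 {{.a, .b, .c}, {.a, .c, .d}, {.a, .b, .d}, {.b, .c, .d}}
        {({.a, .b, .c}, {.a, .c, .d}), ({.a, .b, .d}, {.b, .c, .d})} ∧
      Nonempty (OM A2 ≃o Fin 3 × Fin 3) ∧ Nonempty (IM A2 ≃o Fin 2)) ∧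
    (HasTPoset A3 {{.a, .b, .c}, {.a, .b, .d}, {.b, .c, .d}}
        {({.a, .b, .c}, {.a, .b, .d}), ({.a, .b, .d}, {.b, .c, .d})} ∧
      HasHasseDiagram (OM A3) omA3Edges ∧ Nonempty (IM A3 ≃o Fin 2)) ∧
    (HasTPoset L4 {{.a, .b, .c}, {.a, .c, .d}, {.b, .c, .d}}
        {({.a, .b, .c}, {.a, .c, .d}), ({.a, .b, .c}, {.b, .c, .d})} ∧
      (∃ e : Fin 3 × Fin 3 ≃o OM L4, ∀ i j : Fin 3,
        omL4Label i j = ![(e (i, j)).1 ![.a, .b, .c], (e (i, j)).1 ![.a, .c, .d],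
          (e (i, j)).1 ![.b, .c, .d]]) ∧ Nonempty (IM L4 ≃o Fin 3)) ∧
    (HasTPoset L5 {{.a, .b, .c}, {.a, .c, .d}, {.b, .c, .d}}
        {({.a, .c, .d}, {.a, .b, .c}), ({.b, .c, .d}, {.a, .b, .c})} ∧
      Nonempty (OM L5 ≃o Fin 3 × Fin 3) ∧ Nonempty (IM L5 ≃o Fin 3)) ∧
    (HasTPoset B1 {{.a, .b, .c}}
        ∅ ∧
      Nonempty (OM B1 ≃o M3) ∧ Nonempty (IM B1 ≃o Fin 2)) ∧
    (HasTPoset B2 {{.a, .b, .c}}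
        ∅ ∧
      Nonempty (OM B2 ≃o M3) ∧ Nonempty (IM B2 ≃o Fin 2)) ∧
    (HasTPoset B3 {{.a, .b, .c}}
        ∅ ∧
      Nonempty (OM B3 ≃o Fin 2) ∧ Nonempty (IM B3 ≃o Fin 2)) ∧
    (HasTPoset B4 {{.a, .b, .c}}
        ∅ ∧
      Nonempty (OM B4 ≃o Fin 2) ∧ Nonempty (IM B4 ≃o Fin 2)) := by
  refine ⟨fun L _ _ hcard => ⟨fun hL => ⟨hL.isEmpty_TPoset, hL.nonempty_OM, hL.nonempty_IM⟩,
    fun hL => ?_⟩, fun n => ?_,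
    ⟨M3.hasTPoset, M3.nonempty_OM, M3.nonempty_IM⟩,
    ⟨N5.hasTPoset, N5.nonempty_OM, N5.nonempty_IM⟩,
    ⟨M4.hasTPoset, M4.nonempty_OM, M4.nonempty_IM⟩,
    ⟨A1.hasTPoset, A1.nonempty_OM, A1.card_OM, A1.nonempty_IM⟩,
    ⟨A2.hasTPoset, A2.nonempty_OM, A2.nonempty_IM⟩,
    ⟨A3.hasTPoset, A3.hasHasseDiagram_OM, A3.nonempty_IM⟩,
    ⟨L4.hasTPoset, L4.exists_orderIso_OM, L4.nonempty_IM⟩,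
    ⟨L5.hasTPoset, L5.nonempty_OM, L5.nonempty_IM⟩,
    ⟨B1.hasTPoset, B1.nonempty_OM, B1.nonempty_IM⟩,
    ⟨B2.hasTPoset, B2.nonempty_OM, B2.nonempty_IM⟩,
    ⟨B3.hasTPoset, B3.nonempty_OM, B3.nonempty_IM⟩,
    ⟨B4.hasTPoset, B4.nonempty_OM, B4.nonempty_IM⟩⟩
  · obtain ⟨n, ⟨e⟩⟩ := exists_tableName hcard hL
    exact ⟨n, ⟨e⟩, fun m ⟨e'⟩ => TableName.eq_of_orderIso (e'.symm.trans e)⟩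
  · cases n
    exacts [M3.represents.not_distributive, N5.represents.not_distributive,
      M4.represents.not_distributive, A1.represents.not_distributive,
      A2.represents.not_distributive, A3.represents.not_distributive,
      L4.represents.not_distributive, L5.represents.not_distributive,
      B1.represents.not_distributive, B2.represents.not_distributive,
      B3.represents.not_distributive, B4.represents.not_distributive]
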